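/- For a Borel probability measure $P$ on $\mathbb R^2$ and $n\in\mathbb N$, let $$V_n(P)=\inf\Big\{\int \min_{a\in\alpha}\|x-a\|^2\,dP(x) : \alpha\subset\mathbb R^2,\ \operatorname{card}(\alpha)\le n\Big\}$$ be the $n$th quantization error; a set $\alpha$ with $\operatorname{card}(\alpha)\le n$ attaining the infimum is called an optimal set of $n$-means for $P$. Let $P$ be the uniform distribution on the boundary of the regular hexagon of side length $1$ with vertices $O=A_0=(0,0)$, $A_1=(1,0)$, $A_2=(\frac32,\frac{\sqrt3}2)$, $A_3=(1,\sqrt3)$, $A_4=(0,\sqrt3)$, $A_5=(-\frac12,\frac{\sqrt3}2)$ (density $\frac16$ with respect to arc length). Let $n=6k$ with $k$ a positive integer, and put $$r=\frac{2(\sqrt{13}(k-1)-4)}{13(k-1)^2-16},\qquad \gamma=\Big\{\Big(r+\frac{2j-1}{2(k-1)}(1-2r),\,0\Big): j=1,\dots,k-1\Big\}$$ (so $\gamma=\emptyset$ if $k=1$). Let $T_1,\dots,T_5$ be any affine transformations of $\mathbb R^2$ with $T_i(OA_1)=A_iA_{i+1}$ for $1\le i\le 4$ and $T_5(OA_1)=A_5O$,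 where $AB$ denotes the closed segment joining $A$ and $B$. Then there is exactly one optimal set of $n$-means for $P$, namely $$\alpha_n=\Big\{\big(\tfrac r8,\tfrac{\sqrt3 r}8\big),\big(1-\tfrac r8,\tfrac{\sqrt3 r}8\big),\big(\tfrac{6-r}4,\tfrac{\sqrt3}2\big),\big(1-\tfrac r8,-\tfrac18\sqrt3(r-8)\big),\big(\tfrac r8,-\tfrac18\sqrt3(r-8)\big),\big(\tfrac{r-2}4,\tfrac{\sqrt3}2\big)\Big\}\cup\gamma\cup\bigcup_{i=1}^5T_i(\gamma),$$ and the $n$th quantization error is $$V_n(P)=\frac{13\big(13(k-1)^2-8\sqrt{13}(k-1)+16\big)}{12\big(16-13(k-1)^2\big)^2}.$$ -/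

import Mathlib

open MeasureTheory
open scoped ENNReal

noncomputable section

/-- The Euclidean plane. -/
abbrev Plane : Type := EuclideanSpace ℝ (Fin 2)

/-- The distortion error `∫ min_{a ∈ α} ‖x - a‖² dP(x)` of a set `α` with respect to `P`,
with values in `[0, ∞]`. -/
def distortion (P : Measure Plane) (α : Set Plane) : ℝ≥0∞ :=
  ∫⁻ x, ⨅ a ∈ α, ENNReal.ofReal (‖x - a‖ ^ 2) ∂P

/-- The `n`th quantization error `V_n(P)`: the infimum of the distortion errors over all subsets
of the plane with at most `n` points. -/
def quantizationError (P : Measure Plane) (n : ℕ) : ℝ≥0∞ :=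
  ⨅ (α : Set Plane) (_ : α.encard ≤ n), distortion P α

/-- `α` is an optimal set of `n`-means for `P`: it has at most `n` points and attains the infimum
`V_n(P)`. -/
def IsOptimalSetOfMeans (P : Measure Plane) (n : ℕ) (α : Set Plane) : Prop :=
  α.encard ≤ n ∧ distortion P α = quantizationError P n

/-- The vertices `O = A₀, A₁, …, A₅` of the regular hexagon with side length one, in
counterclockwise order. -/
def hexVertex : Fin 6 → Plane :=
  ![!₂[0, 0], !₂[1, 0], !₂[3 / 2, √3 / 2], !₂[1, √3], !₂[0, √3], !₂[-1 / 2, √3 / 2]]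

/-- The uniform distribution on the boundary of the hexagon: density `1 / 6` with respect to arc
length, each side `A_j A_{j+1}` (indices mod 6, length one) being parametrized by arc length
as `t ↦ t A_{j+1} + (1 - t) A_j` for `0 ≤ t ≤ 1`. -/
def hexUniform : Measure Plane :=
  (6 : ℝ≥0∞)⁻¹ • ∑ j : Fin 6,
    (volume.restrict (Set.Icc (0 : ℝ) 1)).map
      (fun t : ℝ => t • hexVertex (j + 1) + (1 - t) • hexVertex j)

/-- The parameter `r`. The denominator is never zero, as `√13` is irrational. -/
def hexR (k : ℕ) : ℝ :=
  2 * (√13 * ((k : ℝ) - 1) - 4) / (13 * ((k : ℝ) - 1) ^ 2 - 16)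

/-- The six points near the vertices. -/
def hexCorner (r : ℝ) : Set Plane :=
  {!₂[r / 8, √3 * r / 8], !₂[1 - r / 8, √3 * r / 8], !₂[(6 - r) / 4, √3 / 2],
    !₂[1 - r / 8, -(1 / 8) * √3 * (r - 8)], !₂[r / 8, -(1 / 8) * √3 * (r - 8)],
    !₂[(r - 2) / 4, √3 / 2]}

/-- The `k - 1` points `(r + (2j - 1) / (2 (k - 1)) * (1 - 2r), 0)`, `j = 1, …, k - 1`, on the
side `OA₁` (none if `k = 1`). -/
def hexGamma (k : ℕ) (r : ℝ) : Set Plane :=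
  {x | ∃ j : ℕ, 1 ≤ j ∧ j < k ∧
    x = !₂[r + (2 * (j : ℝ) - 1) / (2 * ((k : ℝ) - 1)) * (1 - 2 * r), 0]}

end

/-! Put `r = hexR k` and `ρ = √13/4 · r`; then `1 - 2r = (k-1)·2ρ`, so each side splits into two end
pieces of length `r`, served by corner points, and `k-1` pieces of length `2ρ`, each served by its
midpoint. All these cells reach exactly to distance `ρ`, and each piece has mean squared distance
`13/48 · r²`.

Optimality is a Lagrangian argument with the price `ρ²`. Integrating `ρ² - d(x, A)²` over the
boundary gives at most the sum over `a ∈ A` of the gain of `a`, the integral of `(ρ² - ‖x - a‖²)⁺`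
over its Voronoi cell. Since `2ρ < 1`, a point gains only on two adjacent sides. On one side the
gain is at most `4/3 ρ³`; on the two sides at a vertex it is at most `13/12 r³` (`corner_mass_le`),
which is larger. The larger value is available only at a vertex that the point serves: if another
point of the hexagon is at least as close to the vertex, the two gains together fit under a single
parabola (`gain_add_gain_le`). There are six vertices and at most `6k` points, so the total gain is
at most `6k · 4/3 ρ³ + 6 (13/12 r³ - 4/3 ρ³)`, and the stated configuration attains this bound
(`le_boundaryLoss`).

In the equality case every point is a corner point or a point of a side whose cell contains the full
window of radius `ρ`; packing and covering then fix the positions (`eq_optimalSet`). Points outside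
the hexagon are handled by projecting onto it (`boundaryLoss_le_imp`). -/

namespace HexQuant

/-! ### Oblique frames at the vertices; geometry of the hexagon. -/

/-- The point with coordinates `(x, y)` in the frame spanned by the two edges leaving the
vertex `j` of the hexagon. -/
noncomputable def framePoint (j : Fin 6) (x y : ℝ) : Plane :=
  hexVertex j + x • (hexVertex (j + 1) - hexVertex j) + y • (hexVertex (j - 1) - hexVertex j)

/-- The arc length parametrization of the side from vertex `j` to vertex `j + 1`. -/
noncomputable def side (j : Fin 6) (t : ℝ) : Plane :=
  t • hexVertex (j + 1) + (1 - t) • hexVertex j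

lemma side_eq_framePoint (j : Fin 6) (t : ℝ) : side j t = framePoint j t 0 := by
  simp only [side, framePoint]; module

lemma side_sub_one_eq_framePoint (j : Fin 6) (t : ℝ) :
    side (j - 1) t = framePoint j 0 (1 - t) := by
  simp only [side, framePoint, sub_add_cancel]; module

lemma hexVertex_eq_framePoint (j : Fin 6) : hexVertex j = framePoint j 0 0 := by
  simp [framePoint]

lemma norm_sq_eq (x : Plane) : ‖x‖ ^ 2 = x 0 ^ 2 + x 1 ^ 2 := by
  rw [EuclideanSpace.norm_sq_eq]; simp

/-- The two edges are unit vectors at 120°, with inner product `-1/2`. The form is the same at all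
six vertices, which replaces every appeal to symmetry. -/
lemma norm_sq_framePoint_sub (j : Fin 6) (x y x' y' : ℝ) :
    ‖framePoint j x y - framePoint j x' y'‖ ^ 2 =
      (x - x') ^ 2 + (y - y') ^ 2 - (x - x') * (y - y') := by
  have h3 : √3 ^ 2 = (3 : ℝ) := Real.sq_sqrt (by norm_num)
  rw [norm_sq_eq]
  fin_cases j <;> simp [framePoint, hexVertex, Fin.sub_def, Fin.add_def] <;> ring_nf <;>
    rw [h3] <;> ring

lemma exists_eq_framePoint (j : Fin 6) (z : Plane) : ∃ x y, z = framePoint j x y := by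
  have h3 : √3 ^ 2 = (3 : ℝ) := Real.sq_sqrt (by norm_num)
  set d := z - hexVertex j with hd
  set u := hexVertex (j + 1) - hexVertex j with hu
  set w := hexVertex (j - 1) - hexVertex j with hw
  set p := d 0 * u 0 + d 1 * u 1 with hp
  set q := d 0 * w 0 + d 1 * w 1 with hq
  -- The inverse of the Gram matrix with diagonal `1` and off-diagonal `-1/2`, applied to the inner
  -- products `p`, `q`.
  refine ⟨4 / 3 * (p + q / 2), 4 / 3 * (q + p / 2), ?_⟩
  ext i
  fin_cases j <;> fin_cases i <;>
    simp [framePoint, hexVertex, hp, hq, hd, hu, hw, Fin.sub_def, Fin.add_def] <;> ring_nf <;>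
    (try rw [show √3 ^ 3 = √3 ^ 2 * √3 by ring]) <;> (try rw [h3]) <;> ring

lemma continuous_side (j : Fin 6) : Continuous (side j) := by
  unfold side; fun_prop

/-- The solid hexagon. -/
noncomputable def hexagon : Set Plane := convexHull ℝ (Set.range hexVertex)

lemma hexVertex_add_two (j : Fin 6) : hexVertex (j + 2) = framePoint j 2 1 := by
  ext i
  fin_cases j <;> fin_cases i <;> simp [framePoint, hexVertex, Fin.sub_def, Fin.add_def] <;> ring

lemma hexVertex_add_three (j : Fin 6) : hexVertex (j + 3) = framePoint j 2 2 := by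
  ext i
  fin_cases j <;> fin_cases i <;> simp [framePoint, hexVertex, Fin.sub_def, Fin.add_def] <;> ring

lemma hexVertex_add_four (j : Fin 6) : hexVertex (j + 4) = framePoint j 1 2 := by
  ext i
  fin_cases j <;> fin_cases i <;> simp [framePoint, hexVertex, Fin.sub_def, Fin.add_def] <;> ring

/-- The cone spanned by the two edges at a vertex is convex and contains all six vertices. The signs
are what `gain_add_gain_le` needs of the competing point. -/
lemma exists_nonneg_framePoint (j : Fin 6) {z : Plane} (hz : z ∈ hexagon) :
    ∃ x y, 0 ≤ x ∧ 0 ≤ y ∧ z = framePoint j x y := by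
  have key : hexagon ⊆ {z | ∃ x y, 0 ≤ x ∧ 0 ≤ y ∧ z = framePoint j x y} := by
    apply convexHull_min
    · rintro _ ⟨m, rfl⟩
      have h : ∀ x y : ℝ, 0 ≤ x → 0 ≤ y → hexVertex (j + (m - j)) = framePoint j x y →
          hexVertex m ∈ {z | ∃ x y, 0 ≤ x ∧ 0 ≤ y ∧ z = framePoint j x y} := by
        intro x y hx hy h
        rw [add_sub_cancel] at h
        exact ⟨x, y, hx, hy, h⟩
      generalize m - j = l at h
      fin_cases l
      · exact h 0 0 (by norm_num) (by norm_num) (by simp [framePoint])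
      · exact h 1 0 (by norm_num) (by norm_num) (by simp [framePoint])
      · exact h 2 1 (by norm_num) (by norm_num) (hexVertex_add_two j)
      · exact h 2 2 (by norm_num) (by norm_num) (hexVertex_add_three j)
      · exact h 1 2 (by norm_num) (by norm_num) (hexVertex_add_four j)
      · refine h 0 1 (by norm_num) (by norm_num) ?_
        have : j + 5 = j - 1 := by rw [sub_eq_add_neg]; rfl
        simp [framePoint, this]
    · rintro _ ⟨x, y, hx, hy, rfl⟩ _ ⟨x', y', hx', hy', rfl⟩ a b ha hb hab
      refine ⟨a * x + b * x', a * y + b * y', by positivity, by positivity, ?_⟩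
      obtain rfl : b = 1 - a := by linarith
      simp only [framePoint]; module
  exact key hz

lemma hexVertex_mem_hexagon (j : Fin 6) : hexVertex j ∈ hexagon :=
  subset_convexHull ℝ _ ⟨j, rfl⟩

lemma side_mem_hexagon (j : Fin 6) {t : ℝ} (ht : t ∈ Set.Icc (0 : ℝ) 1) : side j t ∈ hexagon :=
  (convex_convexHull ℝ _) (hexVertex_mem_hexagon (j + 1)) (hexVertex_mem_hexagon j) ht.1
    (by linarith [ht.2]) (by ring)

lemma isClosed_hexagon : IsClosed hexagon :=
  ((Set.finite_range hexVertex).isCompact_convexHull ℝ).isClosed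

lemma one_le_norm_side_sub_of_two_three {i j : Fin 6} (h : j = i + 2 ∨ j = i + 3) {s t : ℝ}
    (hs : s ∈ Set.Icc (0 : ℝ) 1) (ht : t ∈ Set.Icc (0 : ℝ) 1) :
    1 ≤ ‖side i s - side j t‖ := by
  obtain ⟨hs0, hs1⟩ := hs
  obtain ⟨ht0, ht1⟩ := ht
  rw [← one_le_sq_iff₀ (norm_nonneg _), side_eq_framePoint i]
  rcases h with rfl | rfl
  · have : side (i + 2) t = framePoint i 2 (1 + t) := by
      rw [side, add_assoc, show (2 : Fin 6) + 1 = 3 from rfl, hexVertex_add_two,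
        hexVertex_add_three]
      simp only [framePoint]; module
    rw [this, norm_sq_framePoint_sub]
    nlinarith [sq_nonneg (2 - s - (1 + t)), mul_nonneg (sub_nonneg.2 hs1) ht0]
  · have : side (i + 3) t = framePoint i (2 - t) 2 := by
      rw [side, add_assoc, show (3 : Fin 6) + 1 = 4 from rfl, hexVertex_add_three,
        hexVertex_add_four]
      simp only [framePoint]; module
    rw [this, norm_sq_framePoint_sub]
    nlinarith [sq_nonneg (2 - t - s - 1)]

lemma one_le_norm_side_sub {i j : Fin 6} (h : j = i + 2 ∨ j = i + 3 ∨ j = i + 4) {s t : ℝ}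
    (hs : s ∈ Set.Icc (0 : ℝ) 1) (ht : t ∈ Set.Icc (0 : ℝ) 1) :
    1 ≤ ‖side i s - side j t‖ := by
  rcases h with h | h | h
  · exact one_le_norm_side_sub_of_two_three (.inl h) hs ht
  · exact one_le_norm_side_sub_of_two_three (.inr h) hs ht
  · rw [norm_sub_rev]
    refine one_le_norm_side_sub_of_two_three (.inl ?_) ht hs
    subst h; rw [add_assoc]; simp [Fin.add_def]

/-- The angle at the projection onto a convex set is not acute. The surplus `‖a - b‖²` later shows
that an optimal set does not move under the projection. -/
lemma exists_nearest_hexagon (a : Plane) :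
    ∃ b ∈ hexagon, ∀ x ∈ hexagon, ‖x - b‖ ^ 2 + ‖a - b‖ ^ 2 ≤ ‖x - a‖ ^ 2 := by
  obtain ⟨b, hb, hb'⟩ := exists_norm_eq_iInf_of_complete_convex
    ⟨_, hexVertex_mem_hexagon 0⟩ isClosed_hexagon.isComplete
    (convex_convexHull ℝ (Set.range hexVertex)) a
  refine ⟨b, hb, fun x hx => ?_⟩
  have := (norm_eq_iInf_iff_real_inner_le_zero (convex_convexHull ℝ _) hb).1 hb' x hx
  have h2 : x - a = (x - b) - (a - b) := by abel
  rw [h2, norm_sub_sq_real (x - b), real_inner_comm]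
  linarith

/-! ### One-dimensional masses of truncated parabolas. -/

/-- The truncated parabola `y ↦ (ρ² - y²)⁺`. -/
def bump (ρ y : ℝ) : ℝ := max 0 (ρ ^ 2 - y ^ 2)

lemma bump_nonneg (ρ y : ℝ) : 0 ≤ bump ρ y := le_max_left _ _

lemma bump_neg (ρ y : ℝ) : bump ρ (-y) = bump ρ y := by simp [bump]

lemma bump_pos {ρ y : ℝ} (h : y ∈ Set.Ioo (-ρ) ρ) : 0 < bump ρ y :=
  lt_max_of_lt_right (by nlinarith [h.1, h.2])

lemma bump_eq_zero {ρ y : ℝ} (hρ : 0 ≤ ρ) (h : y ∉ Set.Icc (-ρ) ρ) : bump ρ y = 0 := by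
  refine max_eq_left ?_
  by_contra! h'
  exact h (abs_le.1 (abs_le_of_sq_le_sq (by linarith) hρ))

lemma continuous_bump (ρ : ℝ) : Continuous (bump ρ) := by unfold bump; fun_prop

lemma integrable_bump {ρ : ℝ} (hρ : 0 ≤ ρ) : Integrable (bump ρ) :=
  (continuous_bump ρ).integrable_of_hasCompactSupport
    (HasCompactSupport.intro isCompact_Icc fun _ => bump_eq_zero hρ)

lemma integral_bump {ρ : ℝ} (hρ : 0 ≤ ρ) : ∫ y, bump ρ y = 4 / 3 * ρ ^ 3 := by
  rw [← setIntegral_eq_integral_of_forall_compl_eq_zero (s := Set.Icc (-ρ) ρ)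
    (fun _ => bump_eq_zero hρ), integral_Icc_eq_integral_Ioc,
    ← intervalIntegral.integral_of_le (by linarith)]
  have : ∀ y ∈ Set.uIcc (-ρ) ρ, bump ρ y = ρ ^ 2 - y ^ 2 := by
    intro y hy
    rw [Set.uIcc_of_le (by linarith)] at hy
    exact max_eq_right (by nlinarith [hy.1, hy.2])
  rw [intervalIntegral.integral_congr this,
    intervalIntegral.integral_sub (by simp) (by simp), integral_pow]
  simp; ring

lemma integrable_bump_sub {ρ : ℝ} (hρ : 0 ≤ ρ) (p : ℝ) : Integrable fun s => bump ρ (s - p) :=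
  (integrable_bump hρ).comp_sub_right p

lemma integral_bump_sub {ρ : ℝ} (hρ : 0 ≤ ρ) (p : ℝ) :
    ∫ s, bump ρ (s - p) = 4 / 3 * ρ ^ 3 := by
  rw [integral_sub_right_eq_self, integral_bump hρ]

lemma ae_eq_of_le_of_integral_le {F H : ℝ → ℝ} (hF : Integrable F) (hH : Integrable H)
    (h : ∀ y, F y ≤ H y) (hi : ∫ y, H y ≤ ∫ y, F y) : ∀ᵐ y, F y = H y :=
  (integral_eq_iff_of_ae_le hF hH (ae_of_all _ h)).1 (le_antisymm (integral_mono hF hH h) hi)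

/-- Two functions dominated by bumps centred at `p` and `q` and supported in `[s₁, ∞)`,
`[t₁, ∞)` with `p + q < s₁ + t₁` have total mass at most that of one bump, and equality forces
one of them to vanish. -/
lemma integral_add_le_of_separated {ρ p q s₁ t₁ : ℝ} (hρ : 0 < ρ) {G H : ℝ → ℝ}
    (hG : Integrable G) (hH : Integrable H)
    (hG1 : ∀ s, G s ≤ bump ρ (s - p)) (hG0 : ∀ s, 0 ≤ G s)
    (hH1 : ∀ s, H s ≤ bump ρ (s - q)) (hH0 : ∀ s, 0 ≤ H s)
    (hGs : ∀ s, G s ≠ 0 → s₁ ≤ s) (hHs : ∀ s, H s ≠ 0 → t₁ ≤ s) (hst : p + q < s₁ + t₁) :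
    (∫ s, G s) + ∫ s, H s ≤ 4 / 3 * ρ ^ 3 ∧
      (4 / 3 * ρ ^ 3 ≤ (∫ s, G s) + ∫ s, H s → ∫ s, G s = 0 ∨ ∫ s, H s = 0) := by
  -- Centre `G` at the origin by translation and `H` by reflection: the supports lie in `y ≥ s₁ - p`
  -- and `y ≤ q - t₁`, which are disjoint by `hst`, so both fit under one bump.
  have hG' : Integrable fun y => G (y + p) := hG.comp_add_right p
  have hH' : Integrable fun y => H (q - y) := hH.comp_sub_left q
  have hF : Integrable fun y => G (y + p) + H (q - y) := hG'.add hH'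
  have hFi : ∫ y, (G (y + p) + H (q - y)) = (∫ s, G s) + ∫ s, H s := by
    rw [integral_add hG' hH', integral_add_right_eq_self G, integral_sub_left_eq_self H]
  have hle : ∀ y, G (y + p) + H (q - y) ≤ bump ρ y := by
    intro y
    have h1 := hG1 (y + p)
    have h2 := hH1 (q - y)
    rw [add_sub_cancel_right] at h1
    rw [show q - y - q = -y by ring, bump_neg] at h2
    by_cases hg : G (y + p) = 0
    · linarith
    · by_cases hh : H (q - y) = 0
      · linarith
      · linarith [hGs _ hg, hHs _ hh]
  rw [← hFi, ← integral_bump hρ.le]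
  refine ⟨integral_mono hF (integrable_bump hρ.le) hle, fun h => ?_⟩
  have hae := ae_eq_of_le_of_integral_le hF (integrable_bump hρ.le) hle h
  have hgap : ∀ y ∈ Set.Ioo (q - t₁) (s₁ - p), G (y + p) + H (q - y) = 0 := by
    intro y hy
    have h1 : G (y + p) = 0 := by
      by_contra hg; linarith [hGs _ hg, hy.2]
    have h2 : H (q - y) = 0 := by
      by_contra hg; linarith [hHs _ hg, hy.1]
    rw [h1, h2, add_zero]
  -- In the equality case the gap between the supports cannot meet `(-ρ, ρ)`, where the bump is
  -- positive; so one of the two supports misses the bump.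
  have hdis : s₁ - p ≤ -ρ ∨ ρ ≤ q - t₁ := by
    by_contra! hc
    have hne : (Set.Ioo (max (-ρ) (q - t₁)) (min ρ (s₁ - p))).Nonempty :=
      Set.nonempty_Ioo.2 (max_lt (lt_min (by linarith) hc.1) (lt_min hc.2 (by linarith)))
    obtain ⟨y, hy, hy'⟩ := (Measure.dense_of_ae hae).inter_open_nonempty _ isOpen_Ioo hne
    have h1 := hgap y ⟨(le_max_right _ _).trans_lt hy.1, hy.2.trans_le (min_le_right _ _)⟩
    have h2 := bump_pos (ρ := ρ) (y := y)
      ⟨(le_max_left _ _).trans_lt hy.1, hy.2.trans_le (min_le_left _ _)⟩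
    have h3 : G (y + p) + H (q - y) = bump ρ y := hy'
    linarith
  rcases hdis with hd | hd
  · right
    have : ∀ t, H t = 0 := by
      intro t
      by_contra hg
      have h1 := hHs t hg
      have h2 := hH1 t
      rw [bump_eq_zero hρ.le (fun h => by linarith [h.2])] at h2
      exact hg (le_antisymm h2 (hH0 t))
    simp [this]
  · left
    have : ∀ t, G t = 0 := by
      intro t
      by_contra hg
      have h1 := hGs t hg
      have h2 := hG1 t
      rw [bump_eq_zero hρ.le (fun h => by linarith [h.2])] at h2
      exact hg (le_antisymm h2 (hG0 t))
    simp [this]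

/-! ### The best gain at a corner. -/

/-- The mass of `(c + 2 p s - s²)⁺` on the unit interval. -/
noncomputable def sideMass (c p : ℝ) : ℝ := ∫ s in Set.Icc (0 : ℝ) 1, max 0 (c + 2 * p * s - s ^ 2)

lemma sideMass_eq_zero {c p : ℝ} (hc : c ≤ 0) (hp : p ≤ 0) : sideMass c p = 0 := by
  refine setIntegral_eq_zero_of_forall_eq_zero fun s hs => max_eq_left ?_
  nlinarith [hs.1]

/-- A parabola of height `h = c + p²` has mass `4/3 h^(3/2)`. Bounding only the factor `√h` by `ρ`
leaves a bound linear in `h`, which can be added over two sides. -/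
lemma sideMass_le {c p ρ : ℝ} (hρ : 0 ≤ ρ) (h : c + p ^ 2 ≤ ρ ^ 2) :
    sideMass c p ≤ 4 / 3 * ρ * max 0 (c + p ^ 2) := by
  rcases le_or_gt (c + p ^ 2) 0 with h0 | h0
  · rw [max_eq_left h0, mul_zero]
    refine (setIntegral_eq_zero_of_forall_eq_zero fun s hs => max_eq_left ?_).le
    nlinarith [sq_nonneg (s - p)]
  · rw [max_eq_right h0.le]
    have hs := Real.sq_sqrt h0.le
    have h1 : √(c + p ^ 2) ≤ ρ := Real.sqrt_le_left hρ |>.2 h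
    have h2 : sideMass c p ≤ ∫ s, bump √(c + p ^ 2) (s - p) := by
      rw [sideMass]
      have : ∀ s : ℝ, max 0 (c + 2 * p * s - s ^ 2) = bump √(c + p ^ 2) (s - p) := by
        intro s; rw [bump, hs]; ring_nf
      simp only [this]
      exact setIntegral_le_integral (integrable_bump_sub (Real.sqrt_nonneg _) p)
        (ae_of_all _ fun s => bump_nonneg _ _)
    rw [integral_bump_sub (Real.sqrt_nonneg _)] at h2
    have : √(c + p ^ 2) ^ 3 = √(c + p ^ 2) * (c + p ^ 2) := by rw [pow_succ, hs, mul_comm]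
    rw [this] at h2
    nlinarith

/-- For `c ≥ 0` the integrand is nonnegative on an initial interval `[0, S]` of the side and
truncated beyond it. Only `S ≥ 0` is used afterwards, so its value stays hidden. -/
lemma exists_sideMass_eq {c p : ℝ} (hc : 0 ≤ c) :
    ∃ S, 0 ≤ S ∧ sideMass c p = S * c - S ^ 3 / 3 + S ^ 2 * p := by
  have hs := Real.sq_sqrt (show 0 ≤ p ^ 2 + c by positivity)
  set z := √(p ^ 2 + c) with hz
  have hz0 : |p| ≤ z := Real.abs_le_sqrt (by linarith)
  have hz1 := abs_le.1 hz0
  set S := min 1 (p + z) with hS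
  have hS0 : 0 ≤ S := le_min zero_le_one (by linarith)
  have hS1 : S ≤ 1 := min_le_left _ _
  have hfac : ∀ s : ℝ, c + 2 * p * s - s ^ 2 = (p + z - s) * (s + (z - p)) := by
    intro s; linarith [show (p + z - s) * (s + (z - p)) = z ^ 2 - p ^ 2 + 2 * p * s - s ^ 2 by ring]
  refine ⟨S, hS0, ?_⟩
  have hint : ∀ a b : ℝ, IntervalIntegrable (fun s : ℝ => max 0 (c + 2 * p * s - s ^ 2)) volume a b :=
    fun a b => (by fun_prop : Continuous _).intervalIntegrable a b
  rw [sideMass, integral_Icc_eq_integral_Ioc, ← intervalIntegral.integral_of_le zero_le_one,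
    ← intervalIntegral.integral_add_adjacent_intervals (hint 0 S) (hint S 1)]
  have e2 : ∫ s in S..1, max 0 (c + 2 * p * s - s ^ 2) = 0 := by
    rcases le_total 1 (p + z) with h | h
    · rw [hS, min_eq_left h, intervalIntegral.integral_same]
    · have : ∀ s ∈ Set.uIcc S 1, max 0 (c + 2 * p * s - s ^ 2) = 0 := by
        intro s hs'
        rw [Set.uIcc_of_le hS1, hS, min_eq_right h] at hs'
        refine max_eq_left ?_
        rw [hfac]
        nlinarith [hs'.1]
      rw [intervalIntegral.integral_congr this]
      simp
  have e1 : ∀ s ∈ Set.uIcc 0 S, max 0 (c + 2 * p * s - s ^ 2) = c + 2 * p * s - s ^ 2 := by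
    intro s hs'
    rw [Set.uIcc_of_le hS0] at hs'
    refine max_eq_right ?_
    rw [hfac]
    exact mul_nonneg (by linarith [hs'.2, min_le_right 1 (p + z)]) (by linarith [hs'.1])
  rw [intervalIntegral.integral_congr e1, e2]
  rw [intervalIntegral.integral_sub (Continuous.intervalIntegrable (by fun_prop) _ _) (by simp),
    intervalIntegral.integral_add (by simp) (Continuous.intervalIntegrable (by fun_prop) _ _),
    intervalIntegral.integral_const_mul, integral_pow, integral_id]
  simp; ring

lemma four_thirds_lt {r ρ : ℝ} (hr : 0 < r) (hρr : ρ ^ 2 = 13 / 16 * r ^ 2) :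
    4 / 3 * ρ ^ 3 < 13 / 12 * r ^ 3 := by
  have hρ1 : ρ ≤ 92 / 100 * r := by
    refine le_of_sq_le_sq ?_ (by positivity)
    rw [hρr]; nlinarith [sq_nonneg r]
  have : 0 < r ^ 3 := by positivity
  rw [pow_succ, hρr]
  nlinarith [mul_le_mul_of_nonneg_right hρ1 (sq_nonneg r)]

/-- Here `c` is the value of `ρ² - ‖x - a‖²` at the vertex. If `c ≤ 0`, the linear bounds give at
most `4/3 ρ³`, which is too little. If `c > 0`, the mass is a polynomial in the position and in the
served lengths `S`, `T`, and its deficit is a sum of nonnegative terms vanishing together only at `S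
= T = r`. -/
lemma corner_mass_le {r ρ a b : ℝ} (hr : 0 < r) (hρ : 0 < ρ) (hρr : ρ ^ 2 = 13 / 16 * r ^ 2)
    {M : ℝ} (hM : M = sideMass (ρ ^ 2 - (a ^ 2 + b ^ 2 - a * b)) (a - b / 2) +
      sideMass (ρ ^ 2 - (a ^ 2 + b ^ 2 - a * b)) (b - a / 2)) :
    M ≤ 13 / 12 * r ^ 3 ∧ (13 / 12 * r ^ 3 ≤ M → a = r / 4 ∧ b = r / 4) := by
  set c := ρ ^ 2 - (a ^ 2 + b ^ 2 - a * b) with hc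
  set p := a - b / 2 with hp
  set q := b - a / 2 with hq
  have hρ3 : 4 / 3 * ρ * ρ ^ 2 < 13 / 12 * r ^ 3 := by
    linarith [four_thirds_lt hr hρr, show 4 / 3 * ρ * ρ ^ 2 = 4 / 3 * ρ ^ 3 by ring]
  have hcp : c + p ^ 2 ≤ ρ ^ 2 := by
    rw [hc, hp]; nlinarith [sq_nonneg b]
  have hcq : c + q ^ 2 ≤ ρ ^ 2 := by
    rw [hc, hq]; nlinarith [sq_nonneg a]
  have h1 := sideMass_le hρ.le hcp
  have h2 := sideMass_le hρ.le hcq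
  have hm1 : max 0 (c + p ^ 2) ≤ ρ ^ 2 := max_le (sq_nonneg _) hcp
  have hm2 : max 0 (c + q ^ 2) ≤ ρ ^ 2 := max_le (sq_nonneg _) hcq
  have hρ0 : 0 < 4 / 3 * ρ := by positivity
  rcases le_or_gt c 0 with hc0 | hc0
  · have hlt : M < 13 / 12 * r ^ 3 := by
      refine lt_of_le_of_lt ?_ hρ3
      rcases le_or_gt p 0 with hp0 | hp0
      · rw [hM, sideMass_eq_zero hc0 hp0, zero_add]
        exact h2.trans (mul_le_mul_of_nonneg_left hm2 hρ0.le)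
      · rcases le_or_gt q 0 with hq0 | hq0
        · rw [hM, sideMass_eq_zero hc0 hq0, add_zero]
          exact h1.trans (mul_le_mul_of_nonneg_left hm1 hρ0.le)
        · have hA : ρ ^ 2 - c = 4 / 3 * (p ^ 2 + q ^ 2 + p * q) := by rw [hc, hp, hq]; ring
          have hpq := mul_pos hp0 hq0
          have : max 0 (c + p ^ 2) + max 0 (c + q ^ 2) ≤ ρ ^ 2 := by
            rcases max_cases 0 (c + p ^ 2) with ⟨h, _⟩ | ⟨h, _⟩
            · rw [h, zero_add]; exact hm2
            · rcases max_cases 0 (c + q ^ 2) with ⟨h', _⟩ | ⟨h', _⟩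
              · rw [h', add_zero]; exact hm1
              · rw [h, h']; nlinarith [sq_nonneg p, sq_nonneg q]
          rw [hM]
          linarith [mul_le_mul_of_nonneg_left this hρ0.le]
    exact ⟨hlt.le, fun h => absurd h (not_le.2 hlt)⟩
  · obtain ⟨S, hS0, hS⟩ := exists_sideMass_eq (p := p) hc0.le
    obtain ⟨T, hT0, hT⟩ := exists_sideMass_eq (p := q) hc0.le
    rw [hS, hT] at hM
    have hr3 : 0 < r ^ 3 := by positivity
    rcases (add_nonneg hS0 hT0).eq_or_lt with hm | hm
    · have hS1 : S = 0 := by linarith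
      have hT1 : T = 0 := by linarith
      rw [hS1, hT1] at hM
      norm_num at hM
      rw [hM]
      exact ⟨by positivity, fun h => by linarith⟩
    -- For fixed `S`, `T` the mass is a concave quadratic in `(a, b)`, maximal at `(S², T²) / (2(S +
    -- T))`; `x`, `y` are the offsets from there. The three terms of `key` measure the offset, the
    -- imbalance of `S` and `T`, and the deviation of `S + T` from `2r`.
    · set x := a - (2 * S ^ 2) / (4 * (S + T)) with hx
      set y := b - (2 * T ^ 2) / (4 * (S + T)) with hy
      have key : 13 / 12 * r ^ 3 - M = (S + T) * (x ^ 2 + y ^ 2 - x * y) +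
          (S - T) ^ 2 * ((S + T) ^ 2 + 4 * S * T) / (64 * (S + T)) +
          13 / 192 * (S + T - 2 * r) ^ 2 * (S + T + 4 * r) := by
        have hi : (S + T) * (1 / (S + T)) = 1 := by field_simp
        generalize hi' : 1 / (S + T) = i at hi
        have hx' : x = a - S ^ 2 * i / 2 := by rw [hx, ← hi']; field_simp; ring
        have hy' : y = b - T ^ 2 * i / 2 := by rw [hy, ← hi']; field_simp; ring
        have ht : (S - T) ^ 2 * ((S + T) ^ 2 + 4 * S * T) / (64 * (S + T)) =
            (S - T) ^ 2 * ((S + T) ^ 2 + 4 * S * T) * i / 64 := by rw [← hi']; field_simp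
        rw [ht, hM, hx', hy', hc, hp, hq, hρr]
        linear_combination (S ^ 2 * (a - b / 2) + T ^ 2 * (b - a / 2) -
          i * (S ^ 4 + T ^ 4 - S ^ 2 * T ^ 2) / 4 -
          (17 / 64 * (S + T) ^ 3 - (S + T) * S * T)) * hi
      clear_value x y
      have t1 : 0 ≤ (S + T) * (x ^ 2 + y ^ 2 - x * y) :=
        mul_nonneg hm.le (by linarith [sq_nonneg (x - y), sq_nonneg (x + y)])
      have t2 : 0 ≤ (S - T) ^ 2 * ((S + T) ^ 2 + 4 * S * T) / (64 * (S + T)) := by positivity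
      have t3 : 0 ≤ 13 / 192 * (S + T - 2 * r) ^ 2 * (S + T + 4 * r) := by positivity
      refine ⟨by linarith, fun h => ?_⟩
      have u1 : (S + T) * (x ^ 2 + y ^ 2 - x * y) = 0 := by linarith
      have u2 : (S - T) ^ 2 * ((S + T) ^ 2 + 4 * S * T) / (64 * (S + T)) = 0 := by linarith
      have u3 : 13 / 192 * (S + T - 2 * r) ^ 2 * (S + T + 4 * r) = 0 := by linarith
      have v3 : S + T - 2 * r = 0 := by
        have h4 : S + T + 4 * r ≠ 0 := by positivity
        simpa [h4] using u3
      have v2 : S - T = 0 := by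
        have h4 : (S + T) ^ 2 + 4 * S * T ≠ 0 := by positivity
        simpa [h4, hm.ne'] using u2
      have v1 : x ^ 2 + y ^ 2 - x * y = 0 := by
        simpa [hm.ne'] using u1
      have hSr : S = r := by linarith
      have hTr : T = r := by linarith
      have hx0 : x = 0 := by
        rw [← sq_eq_zero_iff]; linarith [sq_nonneg (x - 2 * y), sq_nonneg x]
      have hy0 : y = 0 := by
        rw [← sq_eq_zero_iff]; linarith [sq_nonneg (2 * x - y), sq_nonneg y]
      have e : 2 * r ^ 2 / (4 * (r + r)) = r / 4 := by field_simp; ring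
      rw [hx, hSr, hTr, e] at hx0
      rw [hy, hSr, hTr, e] at hy0
      exact ⟨by linarith, by linarith⟩

/-! ### Voronoi cells and the gain of one point. -/

/-- The closed Voronoi cell of `a` with respect to `α`. -/
def cell (α : Set Plane) (a : Plane) : Set Plane := {x | ∀ b ∈ α, ‖x - a‖ ≤ ‖x - b‖}

lemma isClosed_cell (α : Set Plane) (a : Plane) : IsClosed (cell α a) := by
  have : cell α a = ⋂ b ∈ α, {x | ‖x - a‖ ≤ ‖x - b‖} := by ext; simp [cell]
  rw [this]
  exact isClosed_biInter fun b _ => isClosed_le (by fun_prop) (by fun_prop)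

/-- The gain `(ρ² - ‖x - a‖²)⁺` of the point `a` on the part of a side lying in its cell. -/
noncomputable def sideGain (ρ : ℝ) (α : Set Plane) (a : Plane) (j : Fin 6) : ℝ → ℝ :=
  (Set.Icc (0 : ℝ) 1 ∩ side j ⁻¹' cell α a).indicator fun t => max 0 (ρ ^ 2 - ‖side j t - a‖ ^ 2)

/-- The total gain of the point `a` on a side. -/
noncomputable def gain (ρ : ℝ) (α : Set Plane) (a : Plane) (j : Fin 6) : ℝ :=
  ∫ t, sideGain ρ α a j t

variable {ρ : ℝ} {α : Set Plane} {a : Plane} {j : Fin 6}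

lemma sideGain_nonneg (t : ℝ) : 0 ≤ sideGain ρ α a j t :=
  Set.indicator_nonneg (fun _ _ => le_max_left _ _) t

lemma mem_of_sideGain_ne_zero {t : ℝ} (h : sideGain ρ α a j t ≠ 0) :
    t ∈ Set.Icc (0 : ℝ) 1 ∧ side j t ∈ cell α a :=
  Set.mem_of_indicator_ne_zero (s := Set.Icc (0 : ℝ) 1 ∩ side j ⁻¹' cell α a) h

lemma sideGain_le (t : ℝ) : sideGain ρ α a j t ≤ max 0 (ρ ^ 2 - ‖side j t - a‖ ^ 2) :=
  Set.indicator_le_self' (fun _ _ => le_max_left _ _) t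

lemma integrable_sideGain (ρ : ℝ) (α : Set Plane) (a : Plane) (j : Fin 6) :
    Integrable (sideGain ρ α a j) := by
  have hc : IsClosed (side j ⁻¹' cell α a) := (isClosed_cell α a).preimage (continuous_side j)
  have hK : IsCompact (Set.Icc (0 : ℝ) 1 ∩ side j ⁻¹' cell α a) := isCompact_Icc.inter_right hc
  have := continuous_side j
  exact (integrable_indicator_iff hK.measurableSet).2
    ((by fun_prop : Continuous fun t => max 0 (ρ ^ 2 - ‖side j t - a‖ ^ 2)).continuousOn
      |>.integrableOn_compact hK)

/-- The foot of the perpendicular to the side `j` has parameter `x - y/2`, and the height is `√3/2 ·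
|y|`. -/
lemma norm_sq_side_sub_framePoint (j : Fin 6) (t x y : ℝ) :
    ‖side j t - framePoint j x y‖ ^ 2 = (t - (x - y / 2)) ^ 2 + 3 / 4 * y ^ 2 := by
  rw [side_eq_framePoint, norm_sq_framePoint_sub]; ring

lemma norm_sq_side_sub_one_sub_framePoint (j : Fin 6) (t x y : ℝ) :
    ‖side (j - 1) (1 - t) - framePoint j x y‖ ^ 2 = (t - (y - x / 2)) ^ 2 + 3 / 4 * x ^ 2 := by
  rw [side_sub_one_eq_framePoint, norm_sq_framePoint_sub]; ring

lemma sideGain_le_bump (t x y : ℝ) :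
    sideGain ρ α (framePoint j x y) j t ≤ bump ρ (t - (x - y / 2)) := by
  refine (sideGain_le t).trans ?_
  rw [norm_sq_side_sub_framePoint, bump]
  gcongr
  nlinarith [sq_nonneg y]

lemma sideGain_sub_one_le_bump (t x y : ℝ) :
    sideGain ρ α (framePoint j x y) (j - 1) (1 - t) ≤ bump ρ (t - (y - x / 2)) := by
  refine (sideGain_le _).trans ?_
  rw [norm_sq_side_sub_one_sub_framePoint, bump]
  gcongr
  nlinarith [sq_nonneg x]

lemma integral_sideGain_one_sub : ∫ t, sideGain ρ α a j (1 - t) = gain ρ α a j :=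
  integral_sub_left_eq_self (sideGain ρ α a j) volume 1

lemma gain_le (hρ : 0 < ρ) : gain ρ α a j ≤ 4 / 3 * ρ ^ 3 := by
  obtain ⟨x, y, rfl⟩ := exists_eq_framePoint j a
  rw [← integral_bump_sub hρ.le (x - y / 2)]
  exact integral_mono (integrable_sideGain _ _ _ _) (integrable_bump_sub hρ.le _)
    fun t => sideGain_le_bump t x y

/-- Full gain forces the integrand to be the bump almost everywhere. The window where the bump is
positive then lies in the unit interval and, cells being closed, its closure lies in the cell; a
nonzero height would lower the integrand. -/
lemma exists_side_eq_of_le_gain (hρ : 0 < ρ) (h : 4 / 3 * ρ ^ 3 ≤ gain ρ α a j) :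
    ∃ p, ρ ≤ p ∧ p ≤ 1 - ρ ∧ a = side j p ∧
      ∀ t ∈ Set.Icc (p - ρ) (p + ρ), side j t ∈ cell α a := by
  obtain ⟨x, y, rfl⟩ := exists_eq_framePoint j a
  rw [← integral_bump_sub hρ.le (x - y / 2)] at h
  have hae := ae_eq_of_le_of_integral_le (integrable_sideGain ρ α _ j)
    (integrable_bump_sub hρ.le _) (fun t => sideGain_le_bump t x y) h
  have hd := Measure.dense_of_ae hae
  set p := x - y / 2 with hp
  have hcl : Set.Icc (p - ρ) (p + ρ) ⊆ Set.Icc (0 : ℝ) 1 ∩ side j ⁻¹' cell α (framePoint j x y) := by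
    rw [← closure_Ioo (by linarith : p - ρ ≠ p + ρ)]
    have hcl' : IsClosed (Set.Icc (0 : ℝ) 1 ∩ side j ⁻¹' cell α (framePoint j x y)) :=
      isClosed_Icc.inter ((isClosed_cell _ _).preimage (continuous_side j))
    refine (closure_mono (hd.open_subset_closure_inter isOpen_Ioo)).trans ?_
    rw [closure_closure]
    refine closure_minimal ?_ hcl'
    rintro t ⟨ht, ht'⟩
    refine mem_of_sideGain_ne_zero (ρ := ρ) ?_
    have : sideGain ρ α (framePoint j x y) j t = bump ρ (t - p) := ht'
    rw [this]
    exact (bump_pos ⟨by linarith [ht.1], by linarith [ht.2]⟩).ne'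
  have hy : y = 0 := by
    obtain ⟨t, ht, ht'⟩ := hd.inter_open_nonempty (Set.Ioo (p - ρ) (p + ρ)) isOpen_Ioo
      (Set.nonempty_Ioo.2 (by linarith))
    have e : sideGain ρ α (framePoint j x y) j t = bump ρ (t - p) := ht'
    have hb : 0 < bump ρ (t - p) := bump_pos ⟨by linarith [ht.1], by linarith [ht.2]⟩
    have h1 := sideGain_le (ρ := ρ) (α := α) (a := framePoint j x y) (j := j) t
    rw [e, norm_sq_side_sub_framePoint, ← hp] at h1
    rw [← sq_eq_zero_iff]
    refine le_antisymm ?_ (sq_nonneg y)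
    have h2 : bump ρ (t - p) = ρ ^ 2 - (t - p) ^ 2 := by
      rcases max_choice 0 (ρ ^ 2 - (t - p) ^ 2) with h | h
      · rw [bump, h] at hb; exact absurd hb (lt_irrefl _)
      · exact h
    rcases le_max_iff.1 h1 with h3 | h3 <;> linarith
  have hpx : p = x := by rw [hp, hy]; ring
  refine ⟨p, ?_, ?_, ?_, fun t ht => (hcl ht).2⟩
  · linarith [(hcl (Set.left_mem_Icc.2 (by linarith))).1.1]
  · linarith [(hcl (Set.right_mem_Icc.2 (by linarith))).1.2]
  · rw [hpx, side_eq_framePoint, hy]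

lemma integral_eq_zero_of_ne_zero_imp {F : ℝ → ℝ} (h : ∀ t, F t ≠ 0 → t = 0) : ∫ t, F t = 0 := by
  refine integral_eq_zero_of_ae ?_
  filter_upwards [Measure.ae_ne volume (0 : ℝ)] with t ht
  by_contra hF
  exact ht (h t hF)

/-- If the vertex `m` is served by another point `b` of the hexagon, then the point `a` gains on
the two sides at `m` no more than on a single side. -/
lemma gain_add_gain_le (hρ : 0 < ρ) {m : Fin 6} {b : Plane} (hb : b ∈ α) (hbh : b ∈ hexagon)
    (hab : a ≠ b) (hv : ‖hexVertex m - b‖ ≤ ‖hexVertex m - a‖) :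
    gain ρ α a m + gain ρ α a (m - 1) ≤ 4 / 3 * ρ ^ 3 ∧
      (4 / 3 * ρ ^ 3 ≤ gain ρ α a m + gain ρ α a (m - 1) →
        gain ρ α a m = 0 ∨ gain ρ α a (m - 1) = 0) := by
  suffices h : (gain ρ α a m = 0 ∨ gain ρ α a (m - 1) = 0) ∨
      gain ρ α a m + gain ρ α a (m - 1) ≤ 4 / 3 * ρ ^ 3 ∧
      (4 / 3 * ρ ^ 3 ≤ gain ρ α a m + gain ρ α a (m - 1) →
        gain ρ α a m = 0 ∨ gain ρ α a (m - 1) = 0) by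
    rcases h with h | h
    · refine ⟨?_, fun _ => h⟩
      rcases h with h | h <;> rw [h]
      · rw [zero_add]; exact gain_le hρ
      · rw [add_zero]; exact gain_le hρ
    · exact h
  obtain ⟨x, y, rfl⟩ := exists_eq_framePoint m a
  obtain ⟨β, γ, hβ, hγ, rfl⟩ := exists_nonneg_framePoint m hbh
  rw [hexVertex_eq_framePoint, ← sq_le_sq₀ (norm_nonneg _) (norm_nonneg _),
    norm_sq_framePoint_sub, norm_sq_framePoint_sub] at hv
  -- `E` is the excess of squared distance to the vertex and `P`, `Q` are the differences of the
  -- feet on the two sides. At distance `s` from the vertex, `a` is at least as close as `b` exactly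
  -- when `E ≤ 2Ps`, respectively `E ≤ 2Qs`.
  obtain ⟨E, hE⟩ : ∃ E, E = (x ^ 2 + y ^ 2 - x * y) - (β ^ 2 + γ ^ 2 - β * γ) := ⟨_, rfl⟩
  obtain ⟨P, hP⟩ : ∃ P, P = (x - y / 2) - (β - γ / 2) := ⟨_, rfl⟩
  obtain ⟨Q, hQ⟩ : ∃ Q, Q = (y - x / 2) - (γ - β / 2) := ⟨_, rfl⟩
  have hE0 : 0 ≤ E := by linarith
  have hEPQ : E = 2 * (β * P + γ * Q) + 4 / 3 * (P ^ 2 + Q ^ 2 + P * Q) := by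
    rw [hE, hP, hQ]; ring
  have hG : ∀ s, sideGain ρ α (framePoint m x y) m s ≠ 0 → 0 ≤ s ∧ E ≤ s * (2 * P) := by
    intro s hs
    obtain ⟨h1, h2⟩ := mem_of_sideGain_ne_zero hs
    refine ⟨h1.1, ?_⟩
    have h3 := h2 _ hb
    rw [← sq_le_sq₀ (norm_nonneg _) (norm_nonneg _), norm_sq_side_sub_framePoint,
      norm_sq_side_sub_framePoint] at h3
    rw [hE, hP]; linarith
  have hH : ∀ s, sideGain ρ α (framePoint m x y) (m - 1) (1 - s) ≠ 0 →
      0 ≤ s ∧ E ≤ s * (2 * Q) := by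
    intro s hs
    obtain ⟨h1, h2⟩ := mem_of_sideGain_ne_zero hs
    refine ⟨by linarith [h1.2], ?_⟩
    have h3 := h2 _ hb
    rw [← sq_le_sq₀ (norm_nonneg _) (norm_nonneg _), norm_sq_side_sub_one_sub_framePoint,
      norm_sq_side_sub_one_sub_framePoint] at h3
    rw [hE, hQ]; linarith
  have zG : (P ≤ 0 ∧ 0 < E ∨ P < 0) → gain ρ α (framePoint m x y) m = 0 := by
    intro h
    refine integral_eq_zero_of_ne_zero_imp fun s hs => ?_
    obtain ⟨h1, h2⟩ := hG s hs
    rcases h with ⟨h3, h4⟩ | h3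
    · nlinarith
    · by_contra h4
      have : 0 < s := lt_of_le_of_ne h1 (Ne.symm h4)
      nlinarith
  have zH : (Q ≤ 0 ∧ 0 < E ∨ Q < 0) → gain ρ α (framePoint m x y) (m - 1) = 0 := by
    intro h
    rw [← integral_sideGain_one_sub]
    refine integral_eq_zero_of_ne_zero_imp fun s hs => ?_
    obtain ⟨h1, h2⟩ := hH s hs
    rcases h with ⟨h3, h4⟩ | h3
    · nlinarith
    · by_contra h4
      have : 0 < s := lt_of_le_of_ne h1 (Ne.symm h4)
      nlinarith
  have hPQ0 : ¬ (P = 0 ∧ Q = 0) := by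
    rintro ⟨h1, h2⟩
    apply hab
    have e1 : x = β := by linarith
    have e2 : y = γ := by linarith
    rw [e1, e2]
  rcases lt_trichotomy P 0 with hP0 | hP0 | hP0
  · exact .inl (.inl (zG (.inr hP0)))
  · rcases lt_or_ge Q 0 with hQ0 | hQ0
    · exact .inl (.inr (zH (.inr hQ0)))
    · have hQ1 : 0 < Q := lt_of_le_of_ne hQ0 fun h => hPQ0 ⟨hP0, h.symm⟩
      refine .inl (.inl (zG (.inl ⟨hP0.le, ?_⟩)))
      rw [hEPQ, hP0]
      have := mul_nonneg hγ hQ0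
      have : 0 < Q ^ 2 := by positivity
      linarith
  · have hE1 : Q = 0 → 0 < E := by
      intro h
      rw [hEPQ, h]
      have := mul_nonneg hβ hP0.le
      have : 0 < P ^ 2 := by positivity
      linarith
    rcases lt_trichotomy Q 0 with hQ0 | hQ0 | hQ0
    · exact .inl (.inr (zH (.inr hQ0)))
    · exact .inl (.inr (zH (.inl ⟨hQ0.le, hE1 hQ0⟩)))
    · right
      rw [← integral_sideGain_one_sub (j := m - 1)]
      refine integral_add_le_of_separated (p := x - y / 2) (q := y - x / 2)
        (s₁ := E / (2 * P)) (t₁ := E / (2 * Q)) hρ (integrable_sideGain _ _ _ _)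
        ((integrable_sideGain _ _ _ _).comp_sub_left 1) (fun s => sideGain_le_bump s x y)
        (fun s => sideGain_nonneg s) (fun s => sideGain_sub_one_le_bump s x y)
        (fun s => sideGain_nonneg _) (fun s hs => (div_le_iff₀ (by positivity)).2 (hG s hs).2)
        (fun s hs => (div_le_iff₀ (by positivity)).2 (hH s hs).2) ?_
      -- The bisector meets the sides at `E/(2P)` and `E/(2Q)`. The two bounds add up to `β + γ +
      -- 4/3 (P + Q)`, which exceeds the sum `(β + γ)/2 + P + Q` of the feet of `a`.
      have h1 : β + 2 / 3 * (P + Q) ≤ E / (2 * P) := by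
        rw [le_div_iff₀ (by positivity), hEPQ]
        nlinarith [mul_nonneg hγ hQ0.le, sq_nonneg Q]
      have h2 : γ + 2 / 3 * (P + Q) ≤ E / (2 * Q) := by
        rw [le_div_iff₀ (by positivity), hEPQ]
        nlinarith [mul_nonneg hβ hP0.le, sq_nonneg P]
      linarith

lemma gain_le_sideMass (m : Fin 6) (x y : ℝ) :
    gain ρ α (framePoint m x y) m ≤
      sideMass (ρ ^ 2 - (x ^ 2 + y ^ 2 - x * y)) (x - y / 2) := by
  rw [sideMass, ← integral_indicator measurableSet_Icc]
  refine integral_mono (integrable_sideGain _ _ _ _)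
    ((integrable_indicator_iff measurableSet_Icc).2
      (Continuous.integrableOn_Icc (by fun_prop))) fun t => ?_
  by_cases ht : t ∈ Set.Icc (0 : ℝ) 1
  · rw [Set.indicator_of_mem ht]
    refine (sideGain_le t).trans_eq ?_
    rw [norm_sq_side_sub_framePoint]; ring_nf
  · rw [Set.indicator_of_notMem ht]
    exact (by_contra fun h => ht (mem_of_sideGain_ne_zero h).1 : sideGain _ _ _ _ t = 0).le

lemma gain_sub_one_le_sideMass (m : Fin 6) (x y : ℝ) :
    gain ρ α (framePoint m x y) (m - 1) ≤
      sideMass (ρ ^ 2 - (x ^ 2 + y ^ 2 - x * y)) (y - x / 2) := by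
  rw [sideMass, ← integral_indicator measurableSet_Icc, ← integral_sideGain_one_sub]
  refine integral_mono ((integrable_sideGain _ _ _ _).comp_sub_left 1)
    ((integrable_indicator_iff measurableSet_Icc).2
      (Continuous.integrableOn_Icc (by fun_prop))) fun t => ?_
  by_cases ht : t ∈ Set.Icc (0 : ℝ) 1
  · rw [Set.indicator_of_mem ht]
    refine (sideGain_le _).trans_eq ?_
    rw [norm_sq_side_sub_one_sub_framePoint]; ring_nf
  · rw [Set.indicator_of_notMem ht]
    refine (by_contra fun h => ht ?_ : sideGain _ _ _ _ (1 - t) = 0).le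
    have := (mem_of_sideGain_ne_zero h).1
    exact ⟨by linarith [this.2], by linarith [this.1]⟩

/-- The point serving the corner at the vertex `m`. -/
noncomputable def cornerPoint (r : ℝ) (m : Fin 6) : Plane := framePoint m (r / 4) (r / 4)

lemma gain_add_gain_le_corner {r : ℝ} (hr : 0 < r) (hρ : 0 < ρ)
    (hρr : ρ ^ 2 = 13 / 16 * r ^ 2) (m : Fin 6) :
    gain ρ α a m + gain ρ α a (m - 1) ≤ 13 / 12 * r ^ 3 ∧
      (13 / 12 * r ^ 3 ≤ gain ρ α a m + gain ρ α a (m - 1) → a = cornerPoint r m) := by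
  obtain ⟨x, y, rfl⟩ := exists_eq_framePoint m a
  obtain ⟨h1, h2⟩ := corner_mass_le (a := x) (b := y) hr hρ hρr rfl
  have h3 := gain_le_sideMass (ρ := ρ) (α := α) m x y
  have h4 := gain_sub_one_le_sideMass (ρ := ρ) (α := α) m x y
  refine ⟨by linarith, fun h => ?_⟩
  obtain ⟨rfl, rfl⟩ := h2 (by linarith)
  rfl

lemma one_le_of_norm_le {i j : Fin 6} (h : j = i + 2 ∨ j = i + 3 ∨ j = i + 4) {s t : ℝ}
    (hs : s ∈ Set.Icc (0 : ℝ) 1) (ht : t ∈ Set.Icc (0 : ℝ) 1) (h1 : ‖side i s - a‖ ≤ ρ)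
    (h2 : ‖side j t - a‖ ≤ ρ) : 1 ≤ 2 * ρ := by
  have := norm_sub_le_norm_sub_add_norm_sub (side i s) a (side j t)
  rw [norm_sub_rev a] at this
  linarith [one_le_norm_side_sub h hs ht]

/-- A six-cycle has no triangle, so pairwise equal or adjacent elements lie in one edge. -/
lemma exists_adjacent_of_pairwise (S : Fin 6 → Bool)
    (h : ∀ i j, S i → S j → ¬ (j = i + 2 ∨ j = i + 3 ∨ j = i + 4)) :
    ∃ m, ∀ i, S i → i = m ∨ i = m - 1 := by
  revert S; decide

/-- A point gains only on two adjacent sides. -/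
lemma exists_gain_eq_zero (hρ : 0 < ρ) (hρ2 : 2 * ρ < 1) (α : Set Plane) (a : Plane) :
    ∃ m : Fin 6, ∀ j, j ≠ m → j ≠ m - 1 → gain ρ α a j = 0 := by
  classical
  obtain ⟨m, hm⟩ := exists_adjacent_of_pairwise
    (fun j => decide (∃ t ∈ Set.Icc (0 : ℝ) 1, ‖side j t - a‖ ≤ ρ)) (by
      intro i j hi hj h
      obtain ⟨s, hs, h1⟩ := of_decide_eq_true hi
      obtain ⟨t, ht, h2⟩ := of_decide_eq_true hj
      linarith [one_le_of_norm_le h hs ht h1 h2])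
  refine ⟨m, fun j h1 h2 => ?_⟩
  have : ∀ t, sideGain ρ α a j t = 0 := by
    intro t
    by_contra h
    have ht := (mem_of_sideGain_ne_zero h).1
    have h3 := lt_of_le_of_ne (sideGain_nonneg t) (Ne.symm h) |>.trans_le (sideGain_le t)
    have h4 : ‖side j t - a‖ ≤ ρ := by
      refine le_of_sq_le_sq ?_ hρ.le
      rcases lt_max_iff.1 h3 with h | h
      · exact absurd h (lt_irrefl _)
      · linarith
    rcases hm j (decide_eq_true ⟨t, ht, h4⟩) with h | h
    · exact h1 h
    · exact h2 h
  simp [gain, this]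

lemma sum_gain_eq {m : Fin 6} (h : ∀ j, j ≠ m → j ≠ m - 1 → gain ρ α a j = 0) :
    ∑ j, gain ρ α a j = gain ρ α a m + gain ρ α a (m - 1) :=
  Fintype.sum_eq_add m (m - 1) (by clear h; revert m; decide) fun j hj => h j hj.1 hj.2

/-! ### Summing the gains: the lower bound. -/

/-- The mean squared distance, up to the factor `6`, from the boundary of the hexagon to `α`. -/
noncomputable def boundaryLoss (α : Set Plane) : ℝ :=
  ∑ j : Fin 6, ∫ t in Set.Icc (0 : ℝ) 1, Metric.infDist (side j t) α ^ 2

lemma continuous_infDist_side (j : Fin 6) (α : Set Plane) :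
    Continuous fun t => Metric.infDist (side j t) α :=
  (Metric.continuous_infDist_pt α).comp (continuous_side j)

lemma exists_infDist_eq {A : Finset Plane} (hA : A.Nonempty) (x : Plane) :
    ∃ a ∈ A, Metric.infDist x A = ‖x - a‖ ∧ x ∈ cell A a := by
  obtain ⟨a, ha, h⟩ := A.finite_toSet.isCompact.exists_infDist_eq_dist hA x
  rw [dist_eq_norm] at h
  refine ⟨a, ha, h, fun b hb => ?_⟩
  rw [← h, ← dist_eq_norm]
  exact Metric.infDist_le_dist_of_mem hb

lemma max_sub_infDist_sq_le {ρ : ℝ} {A : Finset Plane} (hA : A.Nonempty) (j : Fin 6) {t : ℝ}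
    (ht : t ∈ Set.Icc (0 : ℝ) 1) :
    max 0 (ρ ^ 2 - Metric.infDist (side j t) A ^ 2) ≤ ∑ a ∈ A, sideGain ρ A a j t := by
  obtain ⟨a, ha, h, hc⟩ := exists_infDist_eq hA (side j t)
  refine le_trans (le_of_eq ?_)
    (Finset.single_le_sum (fun b _ => sideGain_nonneg (ρ := ρ) (a := b) t) ha)
  rw [sideGain, Set.indicator_of_mem (show t ∈ Set.Icc (0 : ℝ) 1 ∩ side j ⁻¹' cell A a from
    ⟨ht, hc⟩), h]

section Global

variable {r ρ : ℝ} {A : Finset Plane} {τ : Fin 6 → Plane}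

/-- The number of vertices of the hexagon served by `a`. -/
noncomputable def served (τ : Fin 6 → Plane) (a : Plane) : ℕ := by
  classical exact (Finset.univ.filter fun j => τ j = a).card

lemma sum_served (hτ : ∀ j, τ j ∈ A) : ∑ a ∈ A, served τ a = 6 := by
  classical
  have := Finset.card_eq_sum_card_fiberwise (s := Finset.univ) (t := A) (f := τ)
    (fun j _ => hτ j)
  simpa [served] using this.symm

lemma served_pos {a : Plane} {m : Fin 6} (h : τ m = a) : 1 ≤ served τ a := by
  classical
  exact Finset.card_pos.2 ⟨m, by simp [h]⟩

lemma eq_of_served_le_one {a : Plane} (h : served τ a ≤ 1) {i j : Fin 6} (hi : τ i = a)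
    (hj : τ j = a) : i = j := by
  classical
  exact Finset.card_le_one.1 h i (by simp [hi]) j (by simp [hj])

/-- The gain of one point, with its equality cases. -/
lemma sum_gain_le (hr : 0 < r) (hρ : 0 < ρ) (hρr : ρ ^ 2 = 13 / 16 * r ^ 2) (hρ2 : 2 * ρ < 1)
    (hAh : ∀ a ∈ A, a ∈ hexagon) (hτ : ∀ j, τ j ∈ A) (hτc : ∀ j, hexVertex j ∈ cell A (τ j))
    {a : Plane} (ha : a ∈ A) :
    ∑ j, gain ρ A a j ≤
      4 / 3 * ρ ^ 3 + served τ a * (13 / 12 * r ^ 3 - 4 / 3 * ρ ^ 3) ∧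
    (4 / 3 * ρ ^ 3 + served τ a * (13 / 12 * r ^ 3 - 4 / 3 * ρ ^ 3) ≤ ∑ j, gain ρ A a j →
      (served τ a = 0 ∧ ∃ j p, ρ ≤ p ∧ p ≤ 1 - ρ ∧ a = side j p ∧
        ∀ t ∈ Set.Icc (p - ρ) (p + ρ), side j t ∈ cell A a) ∨
      (served τ a ≤ 1 ∧ ∃ m, τ m = a ∧ a = cornerPoint r m)) := by
  obtain ⟨m, hm⟩ := exists_gain_eq_zero hρ hρ2 (A : Set Plane) a
  rw [sum_gain_eq hm]
  have hc := sub_pos.2 (four_thirds_lt hr hρr)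
  have hρ3 : 0 < 4 / 3 * ρ ^ 3 := by positivity
  -- If `a` serves other vertices but not `m`, the bound has slack: each served vertex contributes a
  -- positive surplus, by `four_thirds_lt`.
  by_cases hma : τ m = a
  · obtain ⟨h1, h2⟩ := gain_add_gain_le_corner (α := A) (a := a) hr hρ hρr m
    have hs : (1 : ℝ) ≤ served τ a := by exact_mod_cast served_pos hma
    refine ⟨by nlinarith, fun h => .inr ⟨?_, m, hma, h2 (by nlinarith)⟩⟩
    by_contra! h3
    have : (2 : ℝ) ≤ served τ a := by exact_mod_cast h3
    nlinarith
  · obtain ⟨h1, h2⟩ := gain_add_gain_le (α := A) hρ (hτ m) (hAh _ (hτ m)) (Ne.symm hma)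
      (hτc m a ha)
    have hs : (0 : ℝ) ≤ served τ a := by positivity
    refine ⟨by nlinarith, fun h => .inl ⟨?_, ?_⟩⟩
    · by_contra h3
      have : (1 : ℝ) ≤ served τ a := by exact_mod_cast Nat.one_le_iff_ne_zero.2 h3
      nlinarith
    · rcases h2 (by nlinarith) with h4 | h4
      · exact ⟨m - 1, exists_side_eq_of_le_gain hρ (by nlinarith)⟩
      · exact ⟨m, exists_side_eq_of_le_gain hρ (by nlinarith)⟩

lemma integrableOn_infDist_sq (j : Fin 6) (α : Set Plane) :
    IntegrableOn (fun t => Metric.infDist (side j t) α ^ 2) (Set.Icc 0 1) := by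
  have := continuous_infDist_side j α
  exact Continuous.integrableOn_Icc (by fun_prop)

lemma integrableOn_max_sub_infDist_sq (ρ : ℝ) (j : Fin 6) (α : Set Plane) :
    IntegrableOn (fun t => max 0 (ρ ^ 2 - Metric.infDist (side j t) α ^ 2)) (Set.Icc 0 1) := by
  have := continuous_infDist_side j α
  exact Continuous.integrableOn_Icc (by fun_prop)

lemma setIntegral_max_le (hA : A.Nonempty) (j : Fin 6) :
    ∫ t in Set.Icc (0 : ℝ) 1, max 0 (ρ ^ 2 - Metric.infDist (side j t) A ^ 2) ≤
      ∑ a ∈ A, gain ρ A a j := by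
  have h1 : ∫ t in Set.Icc (0 : ℝ) 1, max 0 (ρ ^ 2 - Metric.infDist (side j t) A ^ 2) ≤
      ∫ t in Set.Icc (0 : ℝ) 1, ∑ a ∈ A, sideGain ρ A a j t :=
    setIntegral_mono_on (integrableOn_max_sub_infDist_sq ρ j A)
      (integrable_finsetSum A fun a _ => (integrable_sideGain ρ A a j).integrableOn)
      measurableSet_Icc fun t ht => max_sub_infDist_sq_le hA j ht
  rw [integral_finsetSum A fun a _ => (integrable_sideGain ρ A a j).integrableOn] at h1
  exact h1.trans (Finset.sum_le_sum fun a _ => setIntegral_le_integral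
    (integrable_sideGain ρ A a j) (ae_of_all _ fun t => sideGain_nonneg t))

lemma sq_sub_setIntegral (ρ : ℝ) (j : Fin 6) (α : Set Plane) :
    ∫ t in Set.Icc (0 : ℝ) 1, (ρ ^ 2 - Metric.infDist (side j t) α ^ 2) =
      ρ ^ 2 - ∫ t in Set.Icc (0 : ℝ) 1, Metric.infDist (side j t) α ^ 2 := by
  rw [integral_sub (by simp) (integrableOn_infDist_sq j α)]
  simp

lemma sq_sub_setIntegral_le (ρ : ℝ) (j : Fin 6) (α : Set Plane) :
    ρ ^ 2 - ∫ t in Set.Icc (0 : ℝ) 1, Metric.infDist (side j t) α ^ 2 ≤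
      ∫ t in Set.Icc (0 : ℝ) 1, max 0 (ρ ^ 2 - Metric.infDist (side j t) α ^ 2) := by
  rw [← sq_sub_setIntegral]
  exact setIntegral_mono_on ((integrable_const _).sub (integrableOn_infDist_sq j α))
    (integrableOn_max_sub_infDist_sq ρ j α) measurableSet_Icc fun t _ => le_max_right _ _

/-- A continuous function on the unit interval dominating another one with the same integral
equals it. -/
lemma eq_of_setIntegral_le {f g : ℝ → ℝ} (hf : Continuous f) (hg : Continuous g)
    (hfg : ∀ t ∈ Set.Icc (0 : ℝ) 1, f t ≤ g t)
    (h : ∫ t in Set.Icc (0 : ℝ) 1, g t ≤ ∫ t in Set.Icc (0 : ℝ) 1, f t) :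
    ∀ t ∈ Set.Icc (0 : ℝ) 1, f t = g t := by
  rw [integral_Icc_eq_integral_Ioc, integral_Icc_eq_integral_Ioc,
    ← intervalIntegral.integral_of_le zero_le_one,
    ← intervalIntegral.integral_of_le zero_le_one] at h
  by_contra! hc
  obtain ⟨t, ht, hne⟩ := hc
  exact absurd h (not_le.2 (intervalIntegral.integral_lt_integral_of_continuousOn_of_le_of_exists_lt
    zero_lt_one hf.continuousOn hg.continuousOn (fun t ht => hfg t ⟨ht.1.le, ht.2⟩)
    ⟨t, ht, lt_of_le_of_ne (hfg t ht) hne⟩))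

/-- The lower bound for the loss, with its equality case. -/
theorem le_boundaryLoss (hr : 0 < r) (hρ : 0 < ρ) (hρr : ρ ^ 2 = 13 / 16 * r ^ 2)
    (hρ2 : 2 * ρ < 1) {k : ℕ} (hk : 1 - 2 * r = (k - 1) * (2 * ρ)) (hA : A.Nonempty)
    (hAk : A.card ≤ 6 * k) (hAh : ∀ a ∈ A, a ∈ hexagon) :
    13 / 8 * r ^ 2 ≤ boundaryLoss A ∧ (boundaryLoss A ≤ 13 / 8 * r ^ 2 →
      A.card = 6 * k ∧
      (∀ j, ∀ t ∈ Set.Icc (0 : ℝ) 1, Metric.infDist (side j t) A ≤ ρ) ∧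
      ∀ τ : Fin 6 → Plane, (∀ j, τ j ∈ A) → (∀ j, hexVertex j ∈ cell A (τ j)) → ∀ a ∈ A,
        (served τ a = 0 ∧ ∃ j p, ρ ≤ p ∧ p ≤ 1 - ρ ∧ a = side j p ∧
          ∀ t ∈ Set.Icc (p - ρ) (p + ρ), side j t ∈ cell A a) ∨
        (served τ a ≤ 1 ∧ ∃ m, τ m = a ∧ a = cornerPoint r m)) := by
  set c₁ := 13 / 12 * r ^ 3 - 4 / 3 * ρ ^ 3 with hc₁
  have hρ3 : 0 < 4 / 3 * ρ ^ 3 := by positivity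
  -- The claimed loss uses up the whole budget of `6k` points and six corners; this is where the
  -- tiling relation `hk` enters.
  have hval : 6 * ρ ^ 2 - 13 / 8 * r ^ 2 = (6 * k : ℝ) * (4 / 3 * ρ ^ 3) + 6 * c₁ := by
    have : (6 * k : ℝ) * (4 / 3 * ρ ^ 3) =
        4 * ρ ^ 2 * ((k - 1) * (2 * ρ)) + 6 * (4 / 3 * ρ ^ 3) := by ring
    rw [this, ← hk, hc₁, hρr]; ring
  have hloss : 6 * ρ ^ 2 - boundaryLoss A =
      ∑ j : Fin 6, (ρ ^ 2 - ∫ t in Set.Icc (0 : ℝ) 1, Metric.infDist (side j t) A ^ 2) := by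
    rw [Finset.sum_sub_distrib, boundaryLoss]; simp
  have h1 : ∀ j, ρ ^ 2 - ∫ t in Set.Icc (0 : ℝ) 1, Metric.infDist (side j t) A ^ 2 ≤
      ∫ t in Set.Icc (0 : ℝ) 1, max 0 (ρ ^ 2 - Metric.infDist (side j t) A ^ 2) :=
    fun j => sq_sub_setIntegral_le ρ j A
  have h2 : ∑ j : Fin 6, ∫ t in Set.Icc (0 : ℝ) 1, max 0 (ρ ^ 2 - Metric.infDist (side j t) A ^ 2) ≤
      ∑ a ∈ A, ∑ j, gain ρ A a j := by
    rw [Finset.sum_comm]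
    exact Finset.sum_le_sum fun j _ => setIntegral_max_le hA j
  have h1' := Finset.sum_le_sum fun j (_ : j ∈ Finset.univ) => h1 j
  have hbound : ∀ τ : Fin 6 → Plane, (∀ j, τ j ∈ A) →
      ∑ a ∈ A, (4 / 3 * ρ ^ 3 + served τ a * c₁) = A.card * (4 / 3 * ρ ^ 3) + 6 * c₁ := by
    intro τ hτ
    rw [Finset.sum_add_distrib, Finset.sum_const, nsmul_eq_mul, ← Finset.sum_mul,
      ← Nat.cast_sum, sum_served hτ]
    norm_num
  have hcard : (A.card : ℝ) * (4 / 3 * ρ ^ 3) ≤ (6 * k : ℝ) * (4 / 3 * ρ ^ 3) :=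
    mul_le_mul_of_nonneg_right (by exact_mod_cast hAk) hρ3.le
  choose τ₀ hτ₀ _ hτ₀c using fun j => exists_infDist_eq hA (hexVertex j)
  have h3 : ∀ τ : Fin 6 → Plane, (∀ j, τ j ∈ A) → (∀ j, hexVertex j ∈ cell A (τ j)) → ∀ a ∈ A,
      ∑ j, gain ρ A a j ≤ 4 / 3 * ρ ^ 3 + served τ a * c₁ :=
    fun τ hτ hτc a ha => (sum_gain_le hr hρ hρr hρ2 hAh hτ hτc ha).1
  have h4 := Finset.sum_le_sum (h3 τ₀ hτ₀ hτ₀c)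
  rw [hbound τ₀ hτ₀] at h4
  refine ⟨by linarith, fun hle => ⟨?_, ?_, ?_⟩⟩
  · have : (6 * k : ℝ) ≤ A.card := le_of_mul_le_mul_right (by linarith) hρ3
    exact le_antisymm hAk (by exact_mod_cast this)
  · intro j t ht
    have h5 := (Finset.sum_eq_sum_iff_of_le fun j _ => h1 j).1
      (le_antisymm h1' (by linarith)) j (Finset.mem_univ j)
    rw [← sq_sub_setIntegral] at h5
    have hcont := continuous_infDist_side j A
    have h6 := eq_of_setIntegral_le (by fun_prop) (by fun_prop)
      (fun t _ => le_max_right 0 _) h5.ge t ht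
    have h7 : 0 ≤ ρ ^ 2 - Metric.infDist (side j t) A ^ 2 := by
      rw [h6]; exact le_max_left _ _
    exact le_of_sq_le_sq (by linarith) hρ.le
  · intro τ hτ hτc a ha
    have h4' := Finset.sum_le_sum (h3 τ hτ hτc)
    rw [hbound τ hτ] at h4'
    have h5 := (Finset.sum_eq_sum_iff_of_le (h3 τ hτ hτc)).1
      (le_antisymm (Finset.sum_le_sum (h3 τ hτ hτc)) (by rw [hbound τ hτ]; linarith)) a ha
    exact (sum_gain_le hr hρ hρr hρ2 hAh hτ hτc ha).2 h5.ge

end Global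

/-! ### Rigidity of the equality case. -/

lemma side_zero (m : Fin 6) : side m 0 = hexVertex m := by simp [side]

lemma norm_sq_side_sub_side (j : Fin 6) (s t : ℝ) : ‖side j s - side j t‖ ^ 2 = (s - t) ^ 2 := by
  rw [side_eq_framePoint j t, norm_sq_side_sub_framePoint]; ring

lemma norm_side_sub_side (j : Fin 6) (s t : ℝ) : ‖side j s - side j t‖ = |s - t| := by
  rw [← sq_eq_sq₀ (norm_nonneg _) (abs_nonneg _), norm_sq_side_sub_side, sq_abs]

lemma norm_sq_side_sub_cornerPoint (r : ℝ) (j : Fin 6) (s : ℝ) :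
    ‖side j s - cornerPoint r j‖ ^ 2 = (s - r / 8) ^ 2 + 3 / 64 * r ^ 2 := by
  rw [cornerPoint, norm_sq_side_sub_framePoint]; ring

lemma norm_sq_side_sub_one_sub_cornerPoint (r : ℝ) (j : Fin 6) (s : ℝ) :
    ‖side (j - 1) s - cornerPoint r j‖ ^ 2 = (1 - s - r / 8) ^ 2 + 3 / 64 * r ^ 2 := by
  obtain ⟨t, rfl⟩ : ∃ t, s = 1 - t := ⟨1 - s, by ring⟩
  rw [cornerPoint, norm_sq_side_sub_one_sub_framePoint]; ring

/-- The optimal configuration. -/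
def optimalSet (k : ℕ) (r ρ : ℝ) : Set Plane :=
  Set.range (cornerPoint r) ∪
    {z | ∃ j : Fin 6, ∃ i : ℕ, i + 1 < k ∧ z = side j (r + ρ + 2 * ρ * i)}

/-- The point of parameter `p` on the side `j` belongs to `α`, and its cell contains the
neighbourhood of radius `ρ` of this point in the side. -/
def IsSidePoint (ρ : ℝ) (α : Set Plane) (j : Fin 6) (p : ℝ) : Prop :=
  ρ ≤ p ∧ p ≤ 1 - ρ ∧ side j p ∈ α ∧ ∀ t ∈ Set.Icc (p - ρ) (p + ρ), side j t ∈ cell α (side j p)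

section

variable {r ρ : ℝ} {α : Set Plane}

lemma IsSidePoint.le_norm_left {j : Fin 6} {p : ℝ} (hρ : 0 < ρ) (h : IsSidePoint ρ α j p)
    {b : Plane} (hb : b ∈ α) : ρ ^ 2 ≤ ‖side j (p - ρ) - b‖ ^ 2 := by
  have := h.2.2.2 (p - ρ) ⟨le_rfl, by linarith⟩ b hb
  rw [← sq_le_sq₀ (norm_nonneg _) (norm_nonneg _), norm_sq_side_sub_side] at this
  linarith [this]

lemma IsSidePoint.le_norm_right {j : Fin 6} {p : ℝ} (hρ : 0 < ρ) (h : IsSidePoint ρ α j p)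
    {b : Plane} (hb : b ∈ α) : ρ ^ 2 ≤ ‖side j (p + ρ) - b‖ ^ 2 := by
  have := h.2.2.2 (p + ρ) ⟨by linarith, le_rfl⟩ b hb
  rw [← sq_le_sq₀ (norm_nonneg _) (norm_nonneg _), norm_sq_side_sub_side] at this
  linarith [this]

/-- The corner point is at distance exactly `ρ` from the parameter `r`: the difference of squares is
`(s - r)(s + 3r/4)`. The window therefore cannot begin before `r`. -/
lemma IsSidePoint.add_le (hr : 0 < r) (hρ : 0 < ρ) (hρr : ρ ^ 2 = 13 / 16 * r ^ 2)
    {j : Fin 6} {p : ℝ} (h : IsSidePoint ρ α j p) (hc : cornerPoint r j ∈ α) : r + ρ ≤ p := by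
  have h1 := h.le_norm_left hρ hc
  rw [norm_sq_side_sub_cornerPoint] at h1
  have h2 := h.1
  by_contra! h3
  nlinarith [mul_pos (show 0 < r - (p - ρ) by linarith) (show 0 < (p - ρ) + 3 / 4 * r by linarith)]

lemma IsSidePoint.le_sub (hr : 0 < r) (hρ : 0 < ρ) (hρr : ρ ^ 2 = 13 / 16 * r ^ 2)
    {j : Fin 6} {p : ℝ} (h : IsSidePoint ρ α j p) (hc : cornerPoint r (j + 1) ∈ α) :
    p ≤ 1 - r - ρ := by
  have h1 := h.le_norm_right hρ hc
  have h4 := norm_sq_side_sub_one_sub_cornerPoint r (j + 1) (p + ρ)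
  rw [add_sub_cancel_right] at h4
  rw [h4] at h1
  have h2 := h.2.1
  by_contra! h3
  nlinarith [mul_pos (show 0 < r - (1 - p - ρ) by linarith)
    (show 0 < (1 - p - ρ) + 3 / 4 * r by linarith)]

lemma IsSidePoint.separated (hρ : 0 < ρ) {j : Fin 6} {p q : ℝ} (h : IsSidePoint ρ α j p)
    (hq : IsSidePoint ρ α j q) (hpq : p < q) : p + 2 * ρ ≤ q := by
  have h1 := h.le_norm_right hρ hq.2.2.1
  have h2 := hq.le_norm_left hρ h.2.2.1
  rw [norm_sq_side_sub_side] at h1 h2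
  by_contra! h3
  nlinarith

lemma adjacent_of_not {i j : Fin 6} (h : ¬ (j = i + 2 ∨ j = i + 3 ∨ j = i + 4)) :
    j = i ∨ j = i + 1 ∨ i = j + 1 := by
  revert i j; decide

lemma adjacent_corner {m j : Fin 6} (h : ¬ (j = m + 2 ∨ j = m + 3 ∨ j = m + 4))
    (h' : ¬ (j = m - 1 + 2 ∨ j = m - 1 + 3 ∨ j = m - 1 + 4)) : j = m ∨ j = m - 1 := by
  revert m j; decide

/-- Only points of the side itself reach its middle part. -/
lemma exists_isSidePoint (hr : 0 < r) (hρ : 0 < ρ) (hρr : ρ ^ 2 = 13 / 16 * r ^ 2)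
    (hρ2 : 2 * ρ < 1)
    {a : Plane} (ha : (∃ j p, a = side j p ∧ IsSidePoint ρ α j p) ∨ ∃ m, a = cornerPoint r m)
    {j : Fin 6} {s : ℝ} (hs : s ∈ Set.Ioo r (1 - r)) (hsa : ‖side j s - a‖ ≤ ρ) :
    ∃ p, a = side j p ∧ IsSidePoint ρ α j p := by
  have hs01 : s ∈ Set.Icc (0 : ℝ) 1 := ⟨by linarith [hs.1], by linarith [hs.2]⟩
  have hsa2 : ‖side j s - a‖ ^ 2 ≤ ρ ^ 2 := by gcongr
  rcases ha with ⟨i, p, rfl, hp⟩ | ⟨m, rfl⟩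
  · have hp01 : p ∈ Set.Icc (0 : ℝ) 1 := ⟨by linarith [hp.1], by linarith [hp.2.1]⟩
    have hadj : ¬ (j = i + 2 ∨ j = i + 3 ∨ j = i + 4) := fun h => by
      have := one_le_of_norm_le h hp01 hs01 (by simpa using hρ.le) hsa
      linarith
    rcases adjacent_of_not hadj with rfl | rfl | rfl
    · exact ⟨p, rfl, hp⟩
    -- A side point stays at distance at least `ρ` from the common vertex, and the angle there is
    -- obtuse, so its distance to `side j s` exceeds `ρ`.
    · exfalso
      have h1 := side_sub_one_eq_framePoint (i + 1) p
      rw [add_sub_cancel_right] at h1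
      rw [h1, norm_sq_side_sub_framePoint] at hsa2
      nlinarith [hs.1, hp.2.1]
    · exfalso
      have h1 := side_sub_one_eq_framePoint (j + 1) s
      rw [add_sub_cancel_right] at h1
      rw [norm_sub_rev, h1, norm_sq_side_sub_framePoint] at hsa2
      nlinarith [hs.2, hp.1]
  · exfalso
    have hrρ : (0 - r / 8) ^ 2 + 3 / 64 * r ^ 2 ≤ ρ ^ 2 := by rw [hρr]; nlinarith
    have h0 : ‖side m 0 - cornerPoint r m‖ ≤ ρ := by
      refine le_of_sq_le_sq ?_ hρ.le
      rwa [norm_sq_side_sub_cornerPoint]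
    have h1 : ‖side (m - 1) 1 - cornerPoint r m‖ ≤ ρ := by
      refine le_of_sq_le_sq ?_ hρ.le
      rwa [norm_sq_side_sub_one_sub_cornerPoint, sub_self]
    have hadj := adjacent_corner (m := m) (j := j)
      (fun h => by linarith [one_le_of_norm_le h (by simp) hs01 h0 hsa])
      (fun h => by linarith [one_le_of_norm_le h (by simp) hs01 h1 hsa])
    rcases hadj with rfl | rfl
    · rw [norm_sq_side_sub_cornerPoint, hρr] at hsa2
      nlinarith [mul_pos (sub_pos.2 hs.1) (show 0 < s + 3 / 4 * r by linarith [hs01.1])]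
    · rw [norm_sq_side_sub_one_sub_cornerPoint, hρr] at hsa2
      nlinarith [mul_pos (show 0 < 1 - s - r by linarith [hs.2])
        (show 0 < 1 - s + 3 / 4 * r by linarith [hs01.2])]

/-- A finite set consisting of the corner points and of separated points on the sides, and
reaching the whole boundary, is the optimal configuration. -/
lemma eq_optimalSet {A : Finset Plane} (hA : A.Nonempty) (hr : 0 < r) (hρ : 0 < ρ)
    (hρr : ρ ^ 2 = 13 / 16 * r ^ 2) (hρ2 : 2 * ρ < 1) {k : ℕ}
    (hk : 1 - 2 * r = (k - 1) * (2 * ρ)) (hc : ∀ m, cornerPoint r m ∈ A)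
    (hd : ∀ j, ∀ t ∈ Set.Icc (0 : ℝ) 1, Metric.infDist (side j t) A ≤ ρ)
    (hs : ∀ a ∈ A, (∃ j p, a = side j p ∧ IsSidePoint ρ A j p) ∨ ∃ m, a = cornerPoint r m) :
    (A : Set Plane) = optimalSet k r ρ := by
  have hreach : ∀ j, ∀ s ∈ Set.Ioo r (1 - r), ∃ p, |s - p| ≤ ρ ∧ IsSidePoint ρ A j p := by
    intro j s hsr
    obtain ⟨a, ha, h1, -⟩ := exists_infDist_eq hA (side j s)
    have h2 := hd j s ⟨by linarith [hsr.1], by linarith [hsr.2]⟩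
    rw [h1] at h2
    obtain ⟨p, rfl, hp⟩ := exists_isSidePoint hr hρ hρr hρ2 (hs a ha) hsr h2
    exact ⟨p, by rwa [norm_side_sub_side] at h2, hp⟩
  -- Sweep along the side: if everything up to `σ` is settled, the next centre is at `σ + ρ`. If it
  -- were farther, the uncovered gap before its window would need another centre `q` less than `2ρ`
  -- away from it.
  have hstep : ∀ j σ, r ≤ σ → σ + 2 * ρ ≤ 1 - r →
      (∀ s p, σ < s → |s - p| ≤ ρ → IsSidePoint ρ A j p → σ + ρ ≤ p) →
      IsSidePoint ρ A j (σ + ρ) := by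
    intro j σ h1 h2 h3
    obtain ⟨p, hp, hpA⟩ := hreach j (σ + ρ) ⟨by linarith, by linarith⟩
    have h4 := h3 _ p (by linarith) hp hpA
    have h5 := abs_le.1 hp
    rcases h4.eq_or_lt with h | h
    · rwa [h]
    · obtain ⟨q, hq, hqA⟩ := hreach j ((σ + (p - ρ)) / 2) ⟨by linarith, by linarith⟩
      have h6 := h3 _ q (by linarith) hq hqA
      have h7 := abs_le.1 hq
      have := hqA.separated hρ hpA (by linarith)
      linarith
  have hall : ∀ j, ∀ i : ℕ, i + 1 < k → IsSidePoint ρ A j (r + ρ + 2 * ρ * i) := by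
    intro j i hi
    have hle : (r + 2 * ρ * i) + 2 * ρ ≤ 1 - r := by
      have : (i + 2 : ℝ) ≤ k := by exact_mod_cast hi
      nlinarith
    have hge : r ≤ r + 2 * ρ * i := by
      have : 0 ≤ 2 * ρ * (i : ℝ) := by positivity
      linarith
    rw [show r + ρ + 2 * ρ * (i : ℝ) = (r + 2 * ρ * i) + ρ by ring]
    induction i with
    | zero =>
      refine hstep j _ hge hle fun s p _ _ hp => ?_
      have := hp.add_le hr hρ hρr (hc j)
      simpa using this
    | succ i ih =>
      push_cast at hle ⊢
      have h0 : 0 ≤ 2 * ρ * (i : ℝ) := by positivity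
      have hi' := ih (by omega) (by linarith) (by linarith)
      refine hstep j _ (by linarith) hle fun s p hs hsp hp => ?_
      have h1 := abs_le.1 hsp
      have := hi'.separated hρ hp (by linarith)
      linarith
  apply Set.Subset.antisymm
  · intro a ha
    rcases hs a ha with ⟨j, p, rfl, hp⟩ | ⟨m, rfl⟩
    · right
      have h1 := hp.add_le hr hρ hρr (hc j)
      have h2 := hp.le_sub hr hρ hρr (hc (j + 1))
      -- Rounding down gives a known centre less than `2ρ` to the left of `p` or equal to it;
      -- separation leaves only equality.
      set x := (p - r - ρ) / (2 * ρ) with hx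
      have hpx : p = r + ρ + 2 * ρ * x := by rw [hx]; field_simp; ring
      have hx0 : 0 ≤ x := div_nonneg (by linarith) (by linarith)
      have hf1 := Nat.floor_le hx0
      have hf2 := Nat.lt_floor_add_one x
      have hik : ⌊x⌋₊ + 1 < k := by
        have : (⌊x⌋₊ + 2 : ℝ) ≤ k := by
          by_contra! h
          nlinarith
        have : ⌊x⌋₊ + 2 ≤ k := by exact_mod_cast this
        omega
      refine ⟨j, ⌊x⌋₊, hik, ?_⟩
      have h3 := hall j _ hik
      rcases lt_trichotomy p (r + ρ + 2 * ρ * ⌊x⌋₊) with h | h | h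
      · nlinarith
      · rw [← h]
      · have := h3.separated hρ hp h
        nlinarith
    · exact .inl ⟨m, rfl⟩
  · rintro a (⟨m, rfl⟩ | ⟨j, i, hi, rfl⟩)
    · exact hc m
    · exact (hall j i hi).2.2.1

end

/-! ### From the distortion to the loss. -/

lemma iInf_ofReal_norm_sq {A : Finset Plane} (hA : A.Nonempty) (x : Plane) :
    ⨅ a ∈ (A : Set Plane), ENNReal.ofReal (‖x - a‖ ^ 2) =
      ENNReal.ofReal (Metric.infDist x A ^ 2) := by
  obtain ⟨a, ha, h, hc⟩ := exists_infDist_eq hA x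
  rw [h]
  refine le_antisymm (biInf_le _ ha) (le_iInf₂ fun b hb => ENNReal.ofReal_le_ofReal ?_)
  have := hc b hb
  gcongr

lemma lintegral_hexUniform {f : Plane → ℝ≥0∞} (hf : Measurable f) :
    ∫⁻ x, f x ∂hexUniform = 6⁻¹ * ∑ j : Fin 6, ∫⁻ t in Set.Icc (0 : ℝ) 1, f (side j t) := by
  rw [hexUniform, lintegral_smul_measure, lintegral_finsetSum_measure, smul_eq_mul]
  congr 1
  refine Finset.sum_congr rfl fun j _ => ?_
  exact lintegral_map hf (continuous_side j).measurable

lemma distortion_eq {A : Finset Plane} (hA : A.Nonempty) :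
    distortion hexUniform A = ENNReal.ofReal (boundaryLoss A / 6) := by
  unfold distortion
  simp only [iInf_ofReal_norm_sq hA]
  have hm : Measurable fun x : Plane => ENNReal.ofReal (Metric.infDist x A ^ 2) := by
    have := (Metric.continuous_infDist_pt (A : Set Plane)).measurable
    fun_prop
  rw [lintegral_hexUniform hm, div_eq_inv_mul, ENNReal.ofReal_mul (by norm_num),
    ENNReal.ofReal_inv_of_pos (by norm_num), boundaryLoss, ENNReal.ofReal_sum_of_nonneg fun _ _ => integral_nonneg fun _ => sq_nonneg _]
  congr 1
  · norm_num
  · refine Finset.sum_congr rfl fun j _ => ?_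
    rw [ofReal_integral_eq_lintegral_ofReal (integrableOn_infDist_sq j A)
      (ae_of_all _ fun _ => sq_nonneg _)]

/-- The empty set is treated apart: the infimum over it is `∞`, whereas `Metric.infDist` to it is
`0`. -/
lemma distortion_empty : distortion hexUniform ∅ = ∞ := by
  simp only [distortion, Set.mem_empty_iff_false, iInf_false, iInf_top]
  rw [lintegral_hexUniform measurable_const]
  simp [ENNReal.mul_top]

/-! ### Uniqueness among all finite sets of the plane. -/

section

variable {r ρ : ℝ} {k : ℕ}

/-- Rigidity inside the solid hexagon: a set of small loss is the optimal configuration, and each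
vertex has a unique nearest point. -/
lemma eq_optimalSet_of_boundaryLoss_le {A : Finset Plane} (hr : 0 < r) (hρ : 0 < ρ)
    (hρr : ρ ^ 2 = 13 / 16 * r ^ 2)
    (hρ2 : 2 * ρ < 1) (hk : 1 - 2 * r = (k - 1) * (2 * ρ)) (hA : A.Nonempty)
    (hAk : A.card ≤ 6 * k) (hAh : ∀ a ∈ A, a ∈ hexagon) (hle : boundaryLoss A ≤ 13 / 8 * r ^ 2) :
    A.card = 6 * k ∧ (A : Set Plane) = optimalSet k r ρ ∧
      ∀ m, ∀ b ∈ A, hexVertex m ∈ cell A b → b = cornerPoint r m := by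
  obtain ⟨hcard, hd, hτ⟩ := (le_boundaryLoss hr hρ hρr hρ2 hk hA hAk hAh).2 hle
  have hcorner : ∀ τ : Fin 6 → Plane, (∀ j, τ j ∈ A) → (∀ j, hexVertex j ∈ cell A (τ j)) →
      ∀ m, τ m = cornerPoint r m := by
    intro τ h1 h2 m
    rcases hτ τ h1 h2 (τ m) (h1 m) with ⟨h3, -⟩ | ⟨h3, m', h4, h5⟩
    · have := served_pos (τ := τ) (m := m) rfl
      omega
    · rw [h5, eq_of_served_le_one h3 rfl h4]
  choose τ₀ hτ₀ _ hτ₀c using fun j => exists_infDist_eq hA (hexVertex j)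
  have hc : ∀ m, cornerPoint r m ∈ A := fun m => hcorner τ₀ hτ₀ hτ₀c m ▸ hτ₀ m
  refine ⟨hcard, eq_optimalSet hA hr hρ hρr hρ2 hk hc hd ?_, ?_⟩
  · intro a ha
    rcases hτ τ₀ hτ₀ hτ₀c a ha with ⟨-, j, p, h1, h2, rfl, h4⟩ | ⟨-, m, -, h⟩
    · exact .inl ⟨j, p, rfl, h1, h2, ha, h4⟩
    · exact .inr ⟨m, h⟩
  · intro m b hb hbm
    -- The equality case holds for every choice of nearest points, so `b` may be made the one
    -- serving `m`; this rules out ties.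
    have h := hcorner (Function.update τ₀ m b) ?_ ?_ m
    · simpa using h
    · intro j
      rcases eq_or_ne j m with rfl | hj
      · simpa using hb
      · simpa [hj] using hτ₀ j
    · intro j
      rcases eq_or_ne j m with rfl | hj
      · simpa using hbm
      · simpa [hj] using hτ₀c j

lemma infDist_image_le {A : Finset Plane} (hA : A.Nonempty) [DecidableEq Plane]
    {f : Plane → Plane} (hf : ∀ a, ∀ x ∈ hexagon, ‖x - f a‖ ^ 2 + ‖a - f a‖ ^ 2 ≤ ‖x - a‖ ^ 2)
    {x : Plane} (hx : x ∈ hexagon) :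
    Metric.infDist x (A.image f : Finset Plane) ≤ Metric.infDist x A := by
  obtain ⟨a, ha, h, -⟩ := exists_infDist_eq hA x
  rw [h]
  have h1 : Metric.infDist x (A.image f : Finset Plane) ≤ ‖x - f a‖ := by
    rw [← dist_eq_norm]
    exact Metric.infDist_le_dist_of_mem (by simpa using ⟨a, ha, rfl⟩)
  refine h1.trans ((sq_le_sq₀ (norm_nonneg _) (norm_nonneg _)).1 ?_)
  linarith [hf a x hx, sq_nonneg ‖a - f a‖]

/-- The lower bound for the loss and the uniqueness of the minimizer. -/
theorem boundaryLoss_le_imp {A : Finset Plane} (hr : 0 < r) (hρ : 0 < ρ)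
    (hρr : ρ ^ 2 = 13 / 16 * r ^ 2) (hρ2 : 2 * ρ < 1) (hk : 1 - 2 * r = (k - 1) * (2 * ρ))
    (hA : A.Nonempty) (hAk : A.card ≤ 6 * k) :
    13 / 8 * r ^ 2 ≤ boundaryLoss A ∧
      (boundaryLoss A ≤ 13 / 8 * r ^ 2 → (A : Set Plane) = optimalSet k r ρ) := by
  classical
  choose f hfh hf using exists_nearest_hexagon
  set B := A.image f with hB
  have hBne : B.Nonempty := hA.image f
  have hBk : B.card ≤ 6 * k := Finset.card_image_le.trans hAk
  have hBh : ∀ b ∈ B, b ∈ hexagon := by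
    intro b hb
    obtain ⟨a, -, rfl⟩ := Finset.mem_image.1 hb
    exact hfh a
  have hdist : ∀ j, ∀ t ∈ Set.Icc (0 : ℝ) 1,
      Metric.infDist (side j t) B ≤ Metric.infDist (side j t) A :=
    fun j t ht => infDist_image_le hA hf (side_mem_hexagon j ht)
  have hdist2 : ∀ j, ∀ t ∈ Set.Icc (0 : ℝ) 1,
      Metric.infDist (side j t) B ^ 2 ≤ Metric.infDist (side j t) A ^ 2 := by
    intro j t ht
    have := hdist j t ht
    have := Metric.infDist_nonneg (x := side j t) (s := (B : Set Plane))
    gcongr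
  have hint : ∀ j ∈ Finset.univ, ∫ t in Set.Icc (0 : ℝ) 1, Metric.infDist (side j t) B ^ 2 ≤
      ∫ t in Set.Icc (0 : ℝ) 1, Metric.infDist (side j t) A ^ 2 := fun j _ =>
    setIntegral_mono_on (integrableOn_infDist_sq j B) (integrableOn_infDist_sq j A)
      measurableSet_Icc (hdist2 j)
  have hBA : boundaryLoss B ≤ boundaryLoss A := Finset.sum_le_sum hint
  have hlow := (le_boundaryLoss hr hρ hρr hρ2 hk hBne hBk hBh).1
  refine ⟨hlow.trans hBA, fun hle => ?_⟩
  obtain ⟨hcard, hBo, hnear⟩ :=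
    eq_optimalSet_of_boundaryLoss_le hr hρ hρr hρ2 hk hBne hBk hBh (hBA.trans hle)
  have heq : ∀ j, ∀ t ∈ Set.Icc (0 : ℝ) 1,
      Metric.infDist (side j t) A = Metric.infDist (side j t) B := by
    intro j t ht
    have h1 := (Finset.sum_eq_sum_iff_of_le hint).1
      (le_antisymm hBA (hle.trans hlow)) j (Finset.mem_univ j)
    have hcA := continuous_infDist_side j A
    have hcB := continuous_infDist_side j B
    have h2 := eq_of_setIntegral_le (by fun_prop) (by fun_prop) (hdist2 j) h1.ge t ht
    exact ((sq_eq_sq₀ Metric.infDist_nonneg Metric.infDist_nonneg).1 h2).symm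
  -- Centres on sides are at distance zero from `A`. At a vertex, moving the nearest point of `A`
  -- under `f` would strictly reduce the distance, so that point is fixed and is the corner point.
  have hsub : B ⊆ A := by
    intro b hb
    have hb' : b ∈ optimalSet k r ρ := hBo ▸ hb
    rcases hb' with ⟨m, rfl⟩ | ⟨j, i, hi, rfl⟩
    · obtain ⟨a, ha, h1, -⟩ := exists_infDist_eq hA (hexVertex m)
      have h2 := heq m 0 (by simp)
      rw [side_zero, h1] at h2
      have h3 := hf a (hexVertex m) (hexVertex_mem_hexagon m)
      have hfa : f a ∈ B := Finset.mem_image_of_mem f ha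
      have h4 : ‖hexVertex m - a‖ ≤ ‖hexVertex m - f a‖ := by
        rw [h2, ← dist_eq_norm]
        exact Metric.infDist_le_dist_of_mem hfa
      have h5 : ‖hexVertex m - a‖ ^ 2 ≤ ‖hexVertex m - f a‖ ^ 2 := by gcongr
      have h6 : a = f a := by
        rw [← sub_eq_zero, ← norm_eq_zero, ← sq_eq_zero_iff]
        exact le_antisymm (by linarith) (sq_nonneg _)
      have h7 : hexVertex m ∈ cell B (f a) := by
        intro c hc
        rw [← h6, h2, ← dist_eq_norm]
        exact Metric.infDist_le_dist_of_mem hc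
      rw [← hnear m (f a) hfa h7, ← h6]
      exact ha
    · have hle1 : r + ρ + 2 * ρ * i ≤ 1 := by
        have : (i + 2 : ℝ) ≤ k := by exact_mod_cast hi
        nlinarith
      have h2 := heq j (r + ρ + 2 * ρ * i) ⟨by positivity, hle1⟩
      rw [Metric.infDist_zero_of_mem (show _ ∈ (B : Set Plane) from hb)] at h2
      obtain ⟨a, ha, h1, -⟩ := exists_infDist_eq hA (side j (r + ρ + 2 * ρ * i))
      rw [h2, eq_comm, norm_eq_zero, sub_eq_zero] at h1
      rw [h1]; exact ha
  rw [← hBo, Finset.eq_of_subset_of_card_le hsub (by omega)]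

/-! ### The configuration attains the bound. -/

lemma exists_finset_eq_optimalSet (r ρ : ℝ) (hk : 0 < k) :
    ∃ A : Finset Plane, A.Nonempty ∧ A.card ≤ 6 * k ∧ (A : Set Plane) = optimalSet k r ρ := by
  classical
  refine ⟨Finset.univ.image (cornerPoint r) ∪
    (Finset.univ ×ˢ Finset.range (k - 1)).image
      fun x : Fin 6 × ℕ => side x.1 (r + ρ + 2 * ρ * x.2), ?_, ?_, ?_⟩
  · exact ⟨cornerPoint r 0, by simp⟩
  · refine (Finset.card_union_le _ _).trans ?_
    have h1 := Finset.card_image_le (s := Finset.univ) (f := cornerPoint r)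
    have h2 := Finset.card_image_le (s := Finset.univ ×ˢ Finset.range (k - 1))
      (f := fun x : Fin 6 × ℕ => side x.1 (r + ρ + 2 * ρ * x.2))
    rw [Finset.card_product] at h2
    simp at h1 h2
    omega
  · ext z
    simp only [optimalSet, Finset.coe_union, Finset.coe_image, Finset.coe_univ, Set.image_univ,
      Finset.coe_product, Set.mem_union, Set.mem_image, Set.mem_prod, Set.mem_univ, true_and,
      Finset.coe_range, Set.mem_Iio, Prod.exists, Set.mem_ofPred_eq]
    refine or_congr_right (exists_congr fun j => exists_congr fun i => ?_)
    rw [show i < k - 1 ↔ i + 1 < k by omega, eq_comm]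

lemma infDist_sq_le {α : Set Plane} {x a : Plane} (ha : a ∈ α) :
    Metric.infDist x α ^ 2 ≤ ‖x - a‖ ^ 2 := by
  have h := Metric.infDist_le_dist_of_mem (x := x) ha
  rw [dist_eq_norm] at h
  have := Metric.infDist_nonneg (x := x) (s := α)
  gcongr

lemma integral_sub_sq_add (a b p c : ℝ) :
    ∫ t in a..b, ((t - p) ^ 2 + c) = ((b - p) ^ 3 - (a - p) ^ 3) / 3 + (b - a) * c := by
  rw [intervalIntegral.integral_add (Continuous.intervalIntegrable (by fun_prop) _ _) (by simp),
    intervalIntegral.integral_comp_sub_right (fun t => t ^ 2), integral_pow]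
  simp; ring

/-- Each piece of a side is assigned to its intended point, which bounds the distance from above
without determining the Voronoi cells. Every piece has mean `13/48 · r²`, so the number of pieces
cancels. -/
lemma boundaryLoss_optimalSet_le (hr : 0 < r) (hρ : 0 < ρ)
    (hρr : ρ ^ 2 = 13 / 16 * r ^ 2) (hk0 : 0 < k) (hk : 1 - 2 * r = (k - 1) * (2 * ρ)) :
    boundaryLoss (optimalSet k r ρ) ≤ 13 / 8 * r ^ 2 := by
  have hmain : ∀ j, ∫ t in Set.Icc (0 : ℝ) 1, Metric.infDist (side j t) (optimalSet k r ρ) ^ 2 ≤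
      13 / 48 * r ^ 2 := by
    intro j
    rw [integral_Icc_eq_integral_Ioc, ← intervalIntegral.integral_of_le zero_le_one]
    have hc := continuous_infDist_side j (optimalSet k r ρ)
    set F := fun t => Metric.infDist (side j t) (optimalSet k r ρ) ^ 2 with hF
    have hFi : ∀ a b, IntervalIntegrable F volume a b := fun a b =>
      (by fun_prop : Continuous F).intervalIntegrable a b
    have hpiece : ∀ a b p c : ℝ, a ≤ b → (∀ t, F t ≤ (t - p) ^ 2 + c) →
        ∫ t in a..b, F t ≤ ((b - p) ^ 3 - (a - p) ^ 3) / 3 + (b - a) * c := by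
      intro a b p c hab h
      rw [← integral_sub_sq_add]
      exact intervalIntegral.integral_mono_on hab (hFi a b)
        (Continuous.intervalIntegrable (by fun_prop) _ _) fun t _ => h t
    have h1 := hpiece 0 r (r / 8) (3 / 64 * r ^ 2) hr.le fun t => by
      rw [← norm_sq_side_sub_cornerPoint r j]
      exact infDist_sq_le (.inl ⟨j, rfl⟩)
    have h2 := hpiece (1 - r) 1 (1 - r / 8) (3 / 64 * r ^ 2) (by linarith) fun t => by
      have h := norm_sq_side_sub_one_sub_cornerPoint r (j + 1) t
      rw [add_sub_cancel_right] at h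
      rw [show (t - (1 - r / 8)) ^ 2 = (1 - t - r / 8) ^ 2 by ring, ← h]
      exact infDist_sq_le (.inl ⟨j + 1, rfl⟩)
    have h3 : ∫ t in r..(1 - r), F t ≤ (k - 1) * (2 / 3 * ρ ^ 3) := by
      have hsum := intervalIntegral.sum_integral_adjacent_intervals (f := F) (μ := volume)
        (a := fun i : ℕ => r + 2 * ρ * i) (n := k - 1) fun i _ => hFi _ _
      have hk1 : ((k - 1 : ℕ) : ℝ) = k - 1 := by rw [Nat.cast_sub hk0]; simp
      simp only [hk1, Nat.cast_zero, mul_zero, add_zero] at hsum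
      rw [show r + 2 * ρ * ((k : ℝ) - 1) = 1 - r by linarith] at hsum
      rw [← hsum]
      refine (Finset.sum_le_card_nsmul _ _ (2 / 3 * ρ ^ 3) fun i hi => ?_).trans_eq ?_
      · have hik : i + 1 < k := by have := Finset.mem_range.1 hi; omega
        push_cast
        refine (hpiece _ _ (r + ρ + 2 * ρ * i) 0 (by linarith) fun t => ?_).trans_eq (by ring)
        rw [add_zero, ← norm_sq_side_sub_side j]
        exact infDist_sq_le (.inr ⟨j, i, hik, rfl⟩)
      · rw [Finset.card_range, nsmul_eq_mul, hk1]
    rw [← intervalIntegral.integral_add_adjacent_intervals (hFi 0 r) (hFi r 1),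
      ← intervalIntegral.integral_add_adjacent_intervals (hFi r (1 - r)) (hFi (1 - r) 1)]
    have h4 : (k - 1 : ℝ) * (2 / 3 * ρ ^ 3) = (1 - 2 * r) * (13 / 48 * r ^ 2) := by
      rw [hk, show (k - 1 : ℝ) * (2 / 3 * ρ ^ 3) = (k - 1) * (2 * ρ) * (1 / 3 * ρ ^ 2) by ring, hρr]
      ring
    have e : ((r - r / 8) ^ 3 - (0 - r / 8) ^ 3) / 3 + (r - 0) * (3 / 64 * r ^ 2) +
        ((1 - 2 * r) * (13 / 48 * r ^ 2) + (((1 - (1 - r / 8)) ^ 3 - (1 - r - (1 - r / 8)) ^ 3) / 3 +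
          (1 - (1 - r)) * (3 / 64 * r ^ 2))) = 13 / 48 * r ^ 2 := by ring
    linarith
  refine (Finset.sum_le_card_nsmul _ _ _ fun j _ => hmain j).trans_eq ?_
  simp; ring

end

/-! ### Matching the explicit description. -/

lemma hexCorner_eq (r : ℝ) : hexCorner r = Set.range (cornerPoint r) := by
  have h : cornerPoint r = ![!₂[r / 8, √3 * r / 8], !₂[1 - r / 8, √3 * r / 8],
      !₂[(6 - r) / 4, √3 / 2], !₂[1 - r / 8, -(1 / 8) * √3 * (r - 8)],
      !₂[r / 8, -(1 / 8) * √3 * (r - 8)], !₂[(r - 2) / 4, √3 / 2]] := by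
    ext j i
    fin_cases j <;> fin_cases i <;>
      simp [cornerPoint, framePoint, hexVertex, Fin.sub_def, Fin.add_def] <;> ring
  rw [h, hexCorner]
  simp only [Matrix.range_cons, Matrix.range_empty, Set.union_empty, Set.singleton_union]

lemma side_zero_eq (t : ℝ) : side 0 t = !₂[t, 0] := by
  ext i
  fin_cases i <;> simp [side, hexVertex]

lemma hexGamma_eq {k : ℕ} {r ρ : ℝ} (hk : 1 - 2 * r = (k - 1) * (2 * ρ)) :
    hexGamma k r = {z | ∃ i : ℕ, i + 1 < k ∧ z = side 0 (r + ρ + 2 * ρ * i)} := by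
  have hpar : ∀ i : ℕ, i + 1 < k →
      r + (2 * ((i + 1 : ℕ) : ℝ) - 1) / (2 * ((k : ℝ) - 1)) * (1 - 2 * r) = r + ρ + 2 * ρ * i := by
    intro i hi
    have : (i + 1 : ℝ) < k := by exact_mod_cast hi
    have h0 : (k : ℝ) - 1 ≠ 0 := by
      have : (0 : ℝ) ≤ i := by positivity
      intro h; linarith
    rw [hk]; push_cast; field_simp; ring
  ext z
  constructor
  · rintro ⟨j, h1, h2, rfl⟩
    obtain ⟨i, rfl⟩ : ∃ i, j = i + 1 := ⟨j - 1, by omega⟩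
    exact ⟨i, h2, by rw [hpar i h2, side_zero_eq]⟩
  · rintro ⟨i, hi, rfl⟩
    exact ⟨i + 1, by omega, hi, by rw [hpar i hi, side_zero_eq]⟩

lemma side_injective (j : Fin 6) {s t : ℝ} (h : side j s = side j t) : s = t := by
  have := norm_sq_side_sub_side j s t
  rw [h, sub_self, norm_zero] at this
  rw [← sub_eq_zero, ← sq_eq_zero_iff, ← this]; norm_num

lemma map_side_zero (T : Plane →ᵃ[ℝ] Plane) {j : Fin 6} {s t : ℝ} (h0 : T (hexVertex 0) = side j s)
    (h1 : T (hexVertex 1) = side j t) (x : ℝ) : T (side 0 x) = side j ((1 - x) * s + x * t) := by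
  have : side 0 x = AffineMap.lineMap (hexVertex 0) (hexVertex 1) x := by
    rw [AffineMap.lineMap_apply_module, side, add_comm]; rfl
  rw [this, AffineMap.apply_lineMap, h0, h1, AffineMap.lineMap_apply_module]
  simp only [side]; module

lemma segment_eq_image_side (j : Fin 6) :
    segment ℝ (hexVertex j) (hexVertex (j + 1)) = side j '' Set.Icc 0 1 := by
  rw [segment_eq_image]
  exact Set.image_congr fun t _ => add_comm _ _

/-- An affine map carrying the side `0` onto the side `j` respects or reverses the arc length
parametrizations. -/
lemma map_side_of_image_segment {T : Plane →ᵃ[ℝ] Plane} {j : Fin 6}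
    (h : T '' segment ℝ (hexVertex 0) (hexVertex 1) =
      segment ℝ (hexVertex j) (hexVertex (j + 1))) :
    (∀ x, T (side 0 x) = side j x) ∨ ∀ x, T (side 0 x) = side j (1 - x) := by
  have hseg := segment_eq_image_side 0
  rw [zero_add] at hseg
  rw [hseg, segment_eq_image_side] at h
  obtain ⟨s, hs, h0⟩ : T (side 0 0) ∈ side j '' Set.Icc 0 1 := h ▸ ⟨_, ⟨0, by simp, rfl⟩, rfl⟩
  obtain ⟨t, ht, h1⟩ : T (side 0 1) ∈ side j '' Set.Icc 0 1 := h ▸ ⟨_, ⟨1, by simp, rfl⟩, rfl⟩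
  rw [side_zero] at h0
  rw [show side 0 1 = hexVertex 1 by simp [side]] at h1
  have hT := map_side_zero T h0.symm h1.symm
  obtain ⟨_, ⟨x, hx, rfl⟩, hx'⟩ : side j 0 ∈ T '' (side 0 '' Set.Icc 0 1) :=
    h ▸ ⟨0, by simp, rfl⟩
  obtain ⟨_, ⟨y, hy, rfl⟩, hy'⟩ : side j 1 ∈ T '' (side 0 '' Set.Icc 0 1) :=
    h ▸ ⟨1, by simp, rfl⟩
  rw [hT] at hx' hy'
  have ex := side_injective j hx'
  have ey := side_injective j hy'
  have n1 := mul_nonneg (sub_nonneg.2 hx.2) hs.1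
  have n2 := mul_nonneg hx.1 ht.1
  -- The start of side `j` is a convex combination of the parameters `s`, `t` with value zero, so
  -- both terms vanish.
  rcases mul_eq_zero.1 (show (1 - x) * s = 0 by linarith) with h2 | h2
  · right
    have hx1 : x = 1 := by linarith
    have ht0 : t = 0 := by rw [hx1] at ex; linarith
    have hs1 : s = 1 := by
      rw [ht0] at ey
      nlinarith [hs.2, hy.1, hy.2, hs.1]
    intro z
    rw [hT, hs1, ht0]; ring_nf
  · left
    have ht1 : t = 1 := by
      rw [h2] at ey
      nlinarith [ht.2, hy.1, hy.2, ht.1]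
    intro z
    rw [hT, h2, ht1]; ring_nf

/-- The centres on a side are symmetric under `i ↦ k - 2 - i`, so the orientation chosen by `T` is
irrelevant. -/
lemma image_hexGamma {k : ℕ} {r ρ : ℝ} (hk : 1 - 2 * r = (k - 1) * (2 * ρ))
    {T : Plane →ᵃ[ℝ] Plane} {j : Fin 6}
    (h : T '' segment ℝ (hexVertex 0) (hexVertex 1) =
      segment ℝ (hexVertex j) (hexVertex (j + 1))) :
    T '' hexGamma k r = {z | ∃ i : ℕ, i + 1 < k ∧ z = side j (r + ρ + 2 * ρ * i)} := by
  have hrev : ∀ i : ℕ, i + 1 < k →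
      1 - (r + ρ + 2 * ρ * i) = r + ρ + 2 * ρ * ((k - 2 - i : ℕ) : ℝ) := by
    intro i hi
    rw [Nat.sub_sub, Nat.cast_sub (by omega)]
    push_cast
    linarith
  rw [hexGamma_eq hk]
  ext z
  rcases map_side_of_image_segment h with hT | hT
  · constructor
    · rintro ⟨_, ⟨i, hi, rfl⟩, rfl⟩
      exact ⟨i, hi, hT _⟩
    · rintro ⟨i, hi, rfl⟩
      exact ⟨_, ⟨i, hi, rfl⟩, hT _⟩
  · constructor
    · rintro ⟨_, ⟨i, hi, rfl⟩, rfl⟩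
      exact ⟨k - 2 - i, by omega, by rw [hT, hrev i hi]⟩
    · rintro ⟨i, hi, rfl⟩
      refine ⟨_, ⟨k - 2 - i, by omega, rfl⟩, ?_⟩
      rw [hT, ← hrev i hi, sub_sub_cancel]

lemma optimalSet_eq {k : ℕ} {r ρ : ℝ} (hk : 1 - 2 * r = (k - 1) * (2 * ρ))
    (T : Fin 5 → (Plane →ᵃ[ℝ] Plane))
    (hT : ∀ i : Fin 5, T i '' segment ℝ (hexVertex 0) (hexVertex 1) =
        segment ℝ (hexVertex i.succ) (hexVertex (i.succ + 1))) :
    hexCorner r ∪ hexGamma k r ∪ ⋃ i : Fin 5, T i '' hexGamma k r = optimalSet k r ρ := by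
  rw [hexCorner_eq, Set.union_assoc, optimalSet]
  congr 1
  simp only [fun i => image_hexGamma hk (hT i)]
  rw [hexGamma_eq hk]
  ext z
  simp only [Set.mem_union, Set.mem_iUnion]
  constructor
  · rintro (h | ⟨i, h⟩)
    · exact ⟨0, h⟩
    · exact ⟨i.succ, h⟩
  · rintro ⟨j, h⟩
    refine Fin.cases (motive := fun j => (∃ i : ℕ, i + 1 < k ∧ z = side j (r + ρ + 2 * ρ * i)) → _)
      (fun h => .inl h) (fun i h => .inr ⟨i, h⟩) j h

/-- The denominator factors as `(√13 m - 4)(√13 m + 4)` with `m = k - 1`; it is nonzero because `16`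
is not a multiple of `13`. -/
lemma hexR_eq {k : ℕ} (hk : 0 < k) : hexR k = 2 / (√13 * ((k : ℝ) - 1) + 4) := by
  have h13 : √13 ^ 2 = (13 : ℝ) := Real.sq_sqrt (by norm_num)
  obtain ⟨m, rfl⟩ : ∃ m, k = m + 1 := ⟨k - 1, by omega⟩
  have hne : (13 : ℝ) * m ^ 2 - 16 ≠ 0 := by
    intro h
    have h2 : 13 * m ^ 2 = 16 := by exact_mod_cast sub_eq_zero.1 h
    omega
  have hpos : 0 < √13 * (m : ℝ) + 4 := by positivity
  rw [hexR]
  push_cast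
  rw [add_sub_cancel_right, div_eq_div_iff hne hpos.ne']
  linear_combination 2 * (m : ℝ) ^ 2 * h13

lemma quantizationError_value (k : ℕ) :
    13 * (13 * ((k : ℝ) - 1) ^ 2 - 8 * √13 * ((k : ℝ) - 1) + 16) /
        (12 * (16 - 13 * ((k : ℝ) - 1) ^ 2) ^ 2) = 13 / 48 * hexR k ^ 2 := by
  have h13 : √13 ^ 2 = (13 : ℝ) := Real.sq_sqrt (by norm_num)
  rw [hexR, div_pow]
  have h1 : (16 - 13 * ((k : ℝ) - 1) ^ 2) ^ 2 = (13 * ((k : ℝ) - 1) ^ 2 - 16) ^ 2 := by ring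
  have h2 : 13 * ((k : ℝ) - 1) ^ 2 - 8 * √13 * ((k : ℝ) - 1) + 16 = (√13 * ((k : ℝ) - 1) - 4) ^ 2 := by
    linear_combination -((k : ℝ) - 1) ^ 2 * h13
  rw [h1, h2, mul_pow]
  generalize (13 * ((k : ℝ) - 1) ^ 2 - 16) ^ 2 = d
  ring

end HexQuant

/-! ### Conclusion. -/

open HexQuant in
theorem mainTheorem1 (n k : ℕ) (hk : 0 < k) (hn : n = 6 * k) :
    (∀ T : Fin 5 → (Plane →ᵃ[ℝ] Plane),
      (∀ i : Fin 5, T i '' segment ℝ (hexVertex 0) (hexVertex 1) =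
        segment ℝ (hexVertex i.succ) (hexVertex (i.succ + 1))) →
      ∀ α : Set Plane, IsOptimalSetOfMeans hexUniform n α ↔
        α = hexCorner (hexR k) ∪ hexGamma k (hexR k) ∪ ⋃ i : Fin 5, T i '' hexGamma k (hexR k)) ∧
    quantizationError hexUniform n =
      ENNReal.ofReal (13 * (13 * ((k : ℝ) - 1) ^ 2 - 8 * √13 * ((k : ℝ) - 1) + 16) /
        (12 * (16 - 13 * ((k : ℝ) - 1) ^ 2) ^ 2)) := by
  have h13 : √13 ^ 2 = (13 : ℝ) := Real.sq_sqrt (by norm_num)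
  have h13p : 0 < √13 := Real.sqrt_pos.2 (by norm_num)
  have h13l : √13 < 4 := (Real.sqrt_lt' (by norm_num)).2 (by norm_num)
  have hk1 : (0 : ℝ) ≤ k - 1 := by
    have : (1 : ℝ) ≤ k := by exact_mod_cast hk
    linarith
  have hden : 0 < √13 * ((k : ℝ) - 1) + 4 := by positivity
  have hrdef := hexR_eq hk
  rw [quantizationError_value k]
  set r := hexR k with hr_def
  have hr : 0 < r := by rw [hrdef]; positivity
  have hrmul : r * (√13 * ((k : ℝ) - 1) + 4) = 2 := by rw [hrdef]; field_simp
  have hr2 : r ≤ 1 / 2 := by nlinarith [mul_nonneg hr.le (mul_nonneg h13p.le hk1)]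
  -- The distance from a corner point to the end of its cell on a side, taken as the half-length of
  -- the other cells.
  set ρ := √13 / 4 * r with hρ_def
  have hρ : 0 < ρ := by positivity
  have hρr : ρ ^ 2 = 13 / 16 * r ^ 2 := by rw [hρ_def, mul_pow, div_pow, h13]; norm_num
  have hρ2 : 2 * ρ < 1 := by rw [hρ_def]; nlinarith
  have hkr : 1 - 2 * r = (k - 1) * (2 * ρ) := by rw [hρ_def]; linarith
  have hlow : ∀ α : Set Plane, α.encard ≤ n → ENNReal.ofReal (13 / 48 * r ^ 2) ≤
      distortion hexUniform α ∧ (distortion hexUniform α ≤ ENNReal.ofReal (13 / 48 * r ^ 2) →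
        α = optimalSet k r ρ) := by
    intro α hα
    have hfin : α.Finite := Set.finite_of_encard_le_coe hα
    obtain ⟨A, rfl⟩ : ∃ A : Finset Plane, (A : Set Plane) = α := ⟨hfin.toFinset, by simp⟩
    rcases A.eq_empty_or_nonempty with rfl | hA
    · rw [Finset.coe_empty, distortion_empty]
      exact ⟨le_top, fun h => absurd (top_le_iff.1 h) ENNReal.ofReal_ne_top⟩
    · rw [Set.encard_coe_eq_coe_finsetCard, hn] at hα
      have hAk : A.card ≤ 6 * k := by exact_mod_cast hα
      obtain ⟨h1, h2⟩ := boundaryLoss_le_imp hr hρ hρr hρ2 hkr hA hAk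
      rw [distortion_eq hA]
      refine ⟨ENNReal.ofReal_le_ofReal (by linarith), fun h => h2 ?_⟩
      rw [ENNReal.ofReal_le_ofReal_iff (by positivity)] at h
      linarith
  obtain ⟨B, hB, hBk, hBo⟩ := exists_finset_eq_optimalSet r ρ hk
  have hBcard : (optimalSet k r ρ).encard ≤ n := by
    rw [← hBo, Set.encard_coe_eq_coe_finsetCard, hn]; exact_mod_cast hBk
  have hBd : distortion hexUniform (optimalSet k r ρ) ≤ ENNReal.ofReal (13 / 48 * r ^ 2) := by
    have := boundaryLoss_optimalSet_le hr hρ hρr hk hkr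
    rw [← hBo] at this ⊢
    rw [distortion_eq hB]
    exact ENNReal.ofReal_le_ofReal (by linarith)
  have hV : quantizationError hexUniform n = ENNReal.ofReal (13 / 48 * r ^ 2) :=
    le_antisymm ((iInf₂_le (optimalSet k r ρ) hBcard).trans hBd) (le_iInf₂ fun α hα => (hlow α hα).1)
  refine ⟨fun T hT α => ?_, hV⟩
  rw [optimalSet_eq hkr T hT, IsOptimalSetOfMeans, hV]
  constructor
  · rintro ⟨h1, h2⟩
    exact (hlow α h1).2 h2.le
  · rintro rfl
    exact ⟨hBcard, le_antisymm hBd (hlow _ hBcard).1⟩
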